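/- Let $N\ge 2$, $0\le r\le N$, $\hbar_N=2/\sqrt{N^2-1}$, $[A,B]_N=\hbar_N^{-1}(AB-BA)$. For $s=\frac{N-1}{2}$, $0\le\ell\le N-1$, $-\ell\le m\le \ell$ let $T_{\ell,m}\in\mathbb{C}^{N\times N}$ have the entries $$(T_{\ell,m})_{m_1,m_2}=\sqrt{\tfrac{N}{4\pi}}\,(-1)^{s-m_1}\sqrt{2\ell+1}\begin{pmatrix}s&\ell&s\\-m_1&m&m_2\end{pmatrix},\qquad m_1,m_2\in\{-s,\dots,s\},$$ (Wigner 3j-symbols). They are orthonormal for $\langle A,B\rangle_N=\frac{4\pi}{N}\operatorname{Tr}(A^*B)$. Let $\Delta_N T_{\ell,m}=-\ell(\ell+1)T_{\ell,m}$, and let $P=\Delta_N^{-1}$ be the linear map with $P(T_{\ell,m})=-\frac{1}{\ell(\ell+1)}T_{\ell,m}$ for $\ell\ge1$ and $P(I)=0$. The Zeitlin model on $\mathfrak{u}(N)$ is $\dot W+[P(W),W]_N=0$. Let $\mathrm{St}(r,\mathbb{C}^N)=\{U\in\mathbb{C}^{N\times r}:U^*U=I\}$ and $\mathcal{O}(Y)=\{RYR^*:R\in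 \mathrm{U}(N)\}$. Identify $\mathfrak{u}(N)^*$ with $\mathfrak{u}(N)$ by the Frobenius inner product; the Lie--Poisson bracket is $\{F,G\}(W)=\langle W,[\nabla F(W),\nabla G(W)]_N\rangle_F$. Let $W_0\in\mathfrak{su}(N)$, let the columns of $U_0\in\mathbb{C}^{N\times r}$ be orthonormal eigenvectors of $W_0$ for its $r$ eigenvalues of largest modulus, let $S_0$ be the diagonal matrix of these eigenvalues, and $Y_0=U_0S_0U_0^*$. A *midpoint step* of size $\Delta t>0$ is a pair $U,U'\in\mathbb{C}^{N\times r}$ with $$U'-U=-\hbar_N^{-1}\Delta t\,P(\widetilde US_0\widetilde U^*)\widetilde U,\qquad \widetilde U=\tfrac12(U+U'),$$ that is, a step of the implicit midpoint rule for $\dot U=-\hbar_N^{-1}P(US_0U^*)U$. A *step of the (second order, isospectral) Modin--Viviani integrator* from $Y$ to $Y'$ with stage $X\in\mathfrak{u}(N)$ is given by $$X=Y-\tfrac{\Delta t}{2}[P(X),X]_N+\tfrac{\Delta t^2}{4\hbar_N^2}P(X)XP(X),\qquad Y'=\Big(I-\tfrac{\Delta t}{2\hbar_N}P(X)\Big)X\Big(I+\tfrac{\Delta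 t}{2\hbar_N}P(X)\Big).$$ Then: 1. $U_0\in\mathrm{St}(r,\mathbb{C}^N)$, $Y_0\in\mathfrak{u}(N)$, and $Y_0=\mathrm{svd}_r(W_0)$, i.e. $Y_0$ is a best approximation of $W_0$ of rank at most $r$ in the Frobenius norm. 2. For all $\Delta t>0$: if $U\in \mathrm{St}(r,\mathbb{C}^N)$ and $(U,U')$ is a midpoint step, then $U'\in \mathrm{St}(r,\mathbb{C}^N)$. 3. For all $\Delta t>0$, $U\in\mathrm{St}(r,\mathbb{C}^N)$ and all $X,Y'$: there is a midpoint step $(U,U')$ with $X=\widetilde US_0\widetilde U^*$ and $Y'=U'S_0U'^*$ if and only if the Modin--Viviani integrator has a step from $US_0U^*$ to $Y'$ with stage $X$. Consequently the sequences $Y_\tau=U_\tau S_0U_\tau^*$, where $U_0$ is the given matrix and all $(U_\tau,U_{\tau+1})$ are midpoint steps, are exactly the sequences of Modin--Viviani steps started at $Y_0$; along them $U_\tau\in \mathrm{St}(r,\mathbb{C}^N)$ and $Y_\tau\in\mathcal{O}(Y_0)$. 4. For all $\Delta t>0$, on every open $D\subset\mathfrak{u}(N)$ on which the stage $X$ is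 given as a smooth function of $Y$, the map $\Phi:Y\mapsto Y'$ is smooth, preserves the Lie--Poisson bracket, $\{F\circ\Phi,G\circ\Phi\}=\{F,G\}\circ\Phi$ for all smooth $F,G$, and satisfies $\Phi(Y)\in\mathcal{O}(Y)$. 5. For every $R>\|Y_0\|_F$ there are $\delta>0$ and $C$ such that for $0<\Delta t<\delta$: every $U\in \mathrm{St}(r,\mathbb{C}^N)$ has exactly one midpoint step $(U,U')$; every $Y\in B_R=\{Y\in\mathfrak{u}(N):\|Y\|_F<R\}$ has exactly one Modin--Viviani step, with stage and result $\Phi(Y)$ depending smoothly on $Y$; $\Phi(US_0U^*)=U'S_0U'^*$ for each midpoint step with $U\in \mathrm{St}(r,\mathbb{C}^N)$; $\Phi$ preserves the Lie--Poisson bracket on $B_R$ and $\Phi(Y)\in\mathcal{O}(Y)$; and $\|\Phi(W(0))-W(\Delta t)\|_F\le C\Delta t^3$ for every solution $W$ of the Zeitlin model on $[0,\Delta t]$ with $\|W(0)\|_F<R$. Hence the implicit midpoint rule for the reconstruction equation descends to an isospectral Lie--Poisson integrator of second order for the Zeitlin model with initial condition $Y_0$, which coincides with the Modin--Viviani integrator.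 -/

import Mathlib

open scoped Matrix ContDiff

namespace Zeitlin

/-- The factorial of an integer; it is only evaluated at nonnegative arguments. -/
noncomputable def intFact (z : ℤ) : ℝ := (Nat.factorial z.toNat : ℝ)

/-- The Wigner 3j-symbol `(a/2 b/2 c/2 ; α/2 β/2 γ/2)`, given by Racah's formula.  All arguments
are doubled, so that half-integers become integers.  It vanishes when the selection rules fail. -/
noncomputable def wigner3j (a b c α β γ : ℤ) : ℝ :=
  if α + β + γ = 0 ∧ |α| ≤ a ∧ |β| ≤ b ∧ |γ| ≤ c ∧ Even (a + α) ∧ Even (b + β) ∧ Even (c + γ) ∧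
      |a - b| ≤ c ∧ c ≤ a + b then
    (-1 : ℝ) ^ ((a - b - γ) / 2) *
    Real.sqrt (intFact ((a + b - c) / 2) * intFact ((a - b + c) / 2) * intFact ((-a + b + c) / 2) /
      intFact ((a + b + c) / 2 + 1)) *
    Real.sqrt (intFact ((a + α) / 2) * intFact ((a - α) / 2) * intFact ((b + β) / 2) *
      intFact ((b - β) / 2) * intFact ((c + γ) / 2) * intFact ((c - γ) / 2)) *
    ∑ k ∈ (Finset.range (((a + b - c) / 2).toNat + 1)).filter (fun k : ℕ =>
        (k : ℤ) ≤ (a - α) / 2 ∧ (k : ℤ) ≤ (b + β) / 2 ∧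
        0 ≤ (c - b + α) / 2 + (k : ℤ) ∧ 0 ≤ (c - a - β) / 2 + (k : ℤ)),
      (-1 : ℝ) ^ k /
        (intFact k * intFact ((a + b - c) / 2 - k) * intFact ((a - α) / 2 - k) *
          intFact ((b + β) / 2 - k) * intFact ((c - b + α) / 2 + k) * intFact ((c - a - β) / 2 + k))
  else 0

/-- The matrix `T^N_{ℓ,m}` with entries
`√(N/4π) (-1)^(s-m₁) √(2ℓ+1) (s ℓ s; -m₁ m m₂)`, `s = (N-1)/2`.  The rows and columns are labelled
by `m₁, m₂ ∈ {-s, …, s}` in increasing order: row `i` has `m₁ = i - s`, i.e. `2 m₁ = 2i - (N-1)`. -/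
noncomputable def harmonicMatrix (N : ℕ) (l : ℕ) (m : ℤ) : Matrix (Fin N) (Fin N) ℂ :=
  Matrix.of fun i j =>
    ((Real.sqrt (N / (4 * Real.pi)) * (-1 : ℝ) ^ (N - 1 - (i : ℕ)) * Real.sqrt (2 * l + 1) *
      wigner3j ((N : ℤ) - 1) (2 * l) ((N : ℤ) - 1)
        (-(2 * (i : ℤ) - ((N : ℤ) - 1))) (2 * m) (2 * (j : ℤ) - ((N : ℤ) - 1)) : ℝ) : ℂ)

/-- The scaled Frobenius inner product `⟨A, B⟩_N = (4π/N) Tr(A^* B)`. -/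
noncomputable def innerN {N : ℕ} (A B : Matrix (Fin N) (Fin N) ℂ) : ℂ :=
  ((4 * Real.pi / N : ℝ) : ℂ) * (Aᴴ * B).trace

/-- The operator that multiplies `T^N_{ℓ,m}` by `c ℓ`, written in the `⟨·,·⟩_N`-orthonormal
basis `T^N_{ℓ,m}` (`0 ≤ ℓ ≤ N-1`, `-ℓ ≤ m ≤ ℓ`). -/
noncomputable def spectralOp {N : ℕ} (c : ℕ → ℝ) (W : Matrix (Fin N) (Fin N) ℂ) :
    Matrix (Fin N) (Fin N) ℂ :=
  ∑ l ∈ Finset.range N, ∑ m ∈ Finset.Icc (-(l : ℤ)) (l : ℤ),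
    ((c l : ℂ) * innerN (harmonicMatrix N l m) W) • harmonicMatrix N l m

/-- The quantized Laplacian: `Δ_N T_{ℓ,m} = -ℓ(ℓ+1) T_{ℓ,m}`. -/
noncomputable def laplacian {N : ℕ} (W : Matrix (Fin N) (Fin N) ℂ) : Matrix (Fin N) (Fin N) ℂ :=
  spectralOp (fun l => -((l : ℝ) * (l + 1))) W

/-- The stream matrix `P(W) = Δ_N⁻¹ W`: the solution `P` of `Δ_N P = W` with zero trace, for `W` of
zero trace, extended to all matrices by `P(I) = 0` (the multiples of `I`, spanned by `T_{0,0}`, are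
the kernel of `Δ_N`). -/
noncomputable def streamMatrix {N : ℕ} (W : Matrix (Fin N) (Fin N) ℂ) :
    Matrix (Fin N) (Fin N) ℂ :=
  spectralOp (fun l => if l = 0 then 0 else -(1 / ((l : ℝ) * (l + 1)))) W

/-- `ħ_N = 2 / √(N² - 1)`. -/
noncomputable def hbar (N : ℕ) : ℝ := 2 / Real.sqrt ((N : ℝ) ^ 2 - 1)

/-- The scaled commutator `[A, B]_N = ħ_N⁻¹ (AB - BA)`. -/
noncomputable def commN {N : ℕ} (A B : Matrix (Fin N) (Fin N) ℂ) : Matrix (Fin N) (Fin N) ℂ :=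
  (hbar N)⁻¹ • (A * B - B * A)

/-- The Lie algebra `𝔲(N)` of skew-Hermitian matrices, as a real Euclidean space with the
Frobenius inner product, which identifies it with its dual. -/
def uLie (N : ℕ) : Type := ↥(skewAdjoint (Matrix (Fin N) (Fin N) ℂ))

namespace uLie

variable {N : ℕ}

instance : AddCommGroup (uLie N) :=
  inferInstanceAs (AddCommGroup ↥(skewAdjoint (Matrix (Fin N) (Fin N) ℂ)))

noncomputable instance : Module ℝ (uLie N) :=
  inferInstanceAs (Module ℝ ↥(skewAdjoint (Matrix (Fin N) (Fin N) ℂ)))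

instance : CoeOut (uLie N) (Matrix (Fin N) (Fin N) ℂ) := ⟨fun A => A.1⟩

@[ext] theorem ext {A B : uLie N} (h : (A : Matrix (Fin N) (Fin N) ℂ) = B) : A = B := Subtype.ext h
@[simp] theorem coe_zero : ((0 : uLie N) : Matrix (Fin N) (Fin N) ℂ) = 0 := rfl
@[simp] theorem coe_add (A B : uLie N) : ((A + B : uLie N) : Matrix (Fin N) (Fin N) ℂ) = A + B := rfl
@[simp] theorem coe_sub (A B : uLie N) : ((A - B : uLie N) : Matrix (Fin N) (Fin N) ℂ) = A - B := rfl
@[simp] theorem coe_neg (A : uLie N) : ((-A : uLie N) : Matrix (Fin N) (Fin N) ℂ) = -A := rfl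
@[simp] theorem coe_smul (c : ℝ) (A : uLie N) :
    ((c • A : uLie N) : Matrix (Fin N) (Fin N) ℂ) = c • (A : Matrix (Fin N) (Fin N) ℂ) := rfl
theorem conjTranspose_coe (A : uLie N) :
    (A : Matrix (Fin N) (Fin N) ℂ)ᴴ = -(A : Matrix (Fin N) (Fin N) ℂ) := A.2

/-- The real Frobenius inner product `Re Tr(A^* B)` (which equals `Tr(A^* B)` on `𝔲(N)`). -/
@[reducible] noncomputable def core : InnerProductSpace.Core ℝ (uLie N) where
  inner A B := ((A : Matrix (Fin N) (Fin N) ℂ)ᴴ * (B : Matrix (Fin N) (Fin N) ℂ)).trace.re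
  conj_inner_symm A B := by
    have h : ((A : Matrix (Fin N) (Fin N) ℂ)ᴴ * (B : Matrix (Fin N) (Fin N) ℂ)).trace =
        star ((B : Matrix (Fin N) (Fin N) ℂ)ᴴ * (A : Matrix (Fin N) (Fin N) ℂ)).trace := by
      rw [← Matrix.trace_conjTranspose, Matrix.conjTranspose_mul, Matrix.conjTranspose_conjTranspose]
    simp [h]
  re_inner_nonneg A := by
    simp only [Matrix.trace, Matrix.diag_apply, Matrix.mul_apply, Matrix.conjTranspose_apply]
    simp only [RCLike.star_def, Complex.re_sum, RCLike.re_to_real]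
    refine Finset.sum_nonneg fun i _ => Finset.sum_nonneg fun j _ => ?_
    rw [← Complex.normSq_eq_conj_mul_self, Complex.ofReal_re]
    exact Complex.normSq_nonneg _
  add_left A B C := by
    simp [Matrix.add_mul]
  smul_left A B c := by
    simp
  definite A h := by
    have h' : ∑ i, ∑ j, Complex.normSq ((A : Matrix (Fin N) (Fin N) ℂ) j i) = 0 := by
      rw [← h]
      simp only [Matrix.trace, Matrix.diag_apply, Matrix.mul_apply, Matrix.conjTranspose_apply,
        RCLike.star_def, Complex.re_sum, ← Complex.normSq_eq_conj_mul_self, Complex.ofReal_re]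
    ext i j
    have h1 := (Finset.sum_eq_zero_iff_of_nonneg (fun i _ => Finset.sum_nonneg
      fun j _ => Complex.normSq_nonneg _)).1 h' j (Finset.mem_univ _)
    have h2 := (Finset.sum_eq_zero_iff_of_nonneg (fun j _ => Complex.normSq_nonneg _)).1 h1 i
      (Finset.mem_univ _)
    simpa using h2

noncomputable instance : NormedAddCommGroup (uLie N) := (core (N := N)).toNormedAddCommGroup
noncomputable instance : InnerProductSpace ℝ (uLie N) := InnerProductSpace.ofCore core.toCore

theorem inner_def (A B : uLie N) : inner ℝ A B =
    ((A : Matrix (Fin N) (Fin N) ℂ)ᴴ * (B : Matrix (Fin N) (Fin N) ℂ)).trace.re := rfl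

noncomputable instance : FiniteDimensional ℝ (uLie N) :=
  inferInstanceAs (FiniteDimensional ℝ ↥(skewAdjoint.submodule ℝ (Matrix (Fin N) (Fin N) ℂ)))
instance : CompleteSpace (uLie N) := FiniteDimensional.complete ℝ (uLie N)
end uLie

/-- `W ∈ 𝔰𝔲(N)`. -/
def MemSu {N : ℕ} (W : Matrix (Fin N) (Fin N) ℂ) : Prop := W ∈ skewAdjoint (Matrix (Fin N) (Fin N) ℂ) ∧ W.trace = 0

/-- The Stiefel manifold `St(r, ℂ^N)`. -/
def stiefel (N r : ℕ) : Set (Matrix (Fin N) (Fin r) ℂ) := {U | Uᴴ * U = 1}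

/-- `U₀` consists of orthonormal eigenvectors of `W₀` for its `r` eigenvalues of largest modulus,
and `S₀` is the diagonal matrix of these eigenvalues. -/
def IsLeadingEigen {N r : ℕ} (hr : r ≤ N) (W₀ : Matrix (Fin N) (Fin N) ℂ)
    (U₀ : Matrix (Fin N) (Fin r) ℂ) (S₀ : Matrix (Fin r) (Fin r) ℂ) : Prop :=
  ∃ V ∈ Matrix.unitaryGroup (Fin N) ℂ, ∃ μ : Fin N → ℂ,
    W₀ = V * Matrix.diagonal μ * Vᴴ ∧
    (∀ i j : Fin N, (i : ℕ) < r → r ≤ (j : ℕ) → ‖μ j‖ ≤ ‖μ i‖) ∧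
    U₀ = V.submatrix id (Fin.castLE hr) ∧
    S₀ = Matrix.diagonal (fun i => μ (Fin.castLE hr i))

/-- The Frobenius norm `√Tr(A^* A)`. -/
noncomputable def frobNorm {N : ℕ} (A : Matrix (Fin N) (Fin N) ℂ) : ℝ :=
  Real.sqrt (Aᴴ * A).trace.re

/-- `Y` is a best approximation of `W` of rank at most `r` in the Frobenius norm. -/
def IsBestRankApprox {N : ℕ} (r : ℕ) (W Y : Matrix (Fin N) (Fin N) ℂ) : Prop :=
  Y.rank ≤ r ∧ ∀ Z : Matrix (Fin N) (Fin N) ℂ, Z.rank ≤ r → frobNorm (W - Y) ≤ frobNorm (W - Z)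

/-- The co-adjoint orbit `{R Y R^* : R ∈ U(N)}`. -/
def coadjointOrbit {N : ℕ} (Y : Matrix (Fin N) (Fin N) ℂ) : Set (Matrix (Fin N) (Fin N) ℂ) :=
  {Z | ∃ R ∈ Matrix.unitaryGroup (Fin N) ℂ, Z = R * Y * Rᴴ}

/-- The right-hand side of the reconstruction equation `U' = -ħ_N⁻¹ P(U S₀ U^*) U`. -/
noncomputable def reconField {N r : ℕ} (S₀ : Matrix (Fin r) (Fin r) ℂ)
    (U : Matrix (Fin N) (Fin r) ℂ) : Matrix (Fin N) (Fin r) ℂ :=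
  -((hbar N)⁻¹ • (streamMatrix (U * S₀ * Uᴴ) * U))

/-- One step of size `Δt` of the implicit midpoint rule for `U' = f(U)`. -/
def IsMidpointStep {E : Type*} [AddCommGroup E] [Module ℝ E] (f : E → E) (Δt : ℝ) (U U' : E) :
    Prop :=
  U' - U = Δt • f ((1 / 2 : ℝ) • (U' + U))

/-- The map whose fixed point is the stage of the isospectral integrator:
`W - (Δt/2) [P(X), X]_N + (Δt²/(4ħ_N²)) P(X) X P(X)`. -/
noncomputable def isoStageMap {N : ℕ} (Δt : ℝ) (W X : Matrix (Fin N) (Fin N) ℂ) :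
    Matrix (Fin N) (Fin N) ℂ :=
  W - (Δt / 2) • commN (streamMatrix X) X +
    (Δt ^ 2 / (4 * hbar N ^ 2)) • (streamMatrix X * X * streamMatrix X)

/-- The update `(I - (Δt/2ħ_N) P(X)) X (I + (Δt/2ħ_N) P(X))`. -/
noncomputable def isoUpdate {N : ℕ} (Δt : ℝ) (X : Matrix (Fin N) (Fin N) ℂ) :
    Matrix (Fin N) (Fin N) ℂ :=
  (1 - (Δt / (2 * hbar N)) • streamMatrix X) * X * (1 + (Δt / (2 * hbar N)) • streamMatrix X)

/-- `W'` is obtained from `W` by one step of the second order Modin-Viviani integrator on `𝔲(N)`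
with time step `Δt` and stage `X`. -/
def IsIsoStep {N : ℕ} (Δt : ℝ) (W X W' : Matrix (Fin N) (Fin N) ℂ) : Prop :=
  X ∈ skewAdjoint (Matrix (Fin N) (Fin N) ℂ) ∧ X = isoStageMap Δt W X ∧ W' = isoUpdate Δt X

/-- `W` solves the Zeitlin model `W' + [P(W), W]_N = 0`, `Δ_N P(W) = W`, in `𝔲(N)` on `[0, T]`. -/
def IsZeitlinSolution {N : ℕ} (T : ℝ) (W : ℝ → uLie N) : Prop :=
  ∀ t ∈ Set.Icc 0 T, ∃ V : uLie N,
    (V : Matrix (Fin N) (Fin N) ℂ) = -commN (streamMatrix (W t)) (W t) ∧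
    HasDerivWithinAt W V (Set.Icc 0 T) t

/-- The Lie-Poisson bracket `{F, G}(W) = ⟨W, [∇F(W), ∇G(W)]_N⟩` of functions on the dual of
`𝔲(N)`, which is identified with `𝔲(N)` by the Frobenius inner product. -/
noncomputable def lpBracket {N : ℕ} (F G : uLie N → ℝ) (W : uLie N) : ℝ :=
  ((W : Matrix (Fin N) (Fin N) ℂ)ᴴ *
    commN ((gradient F W : uLie N) : Matrix (Fin N) (Fin N) ℂ)
      ((gradient G W : uLie N) : Matrix (Fin N) (Fin N) ℂ)).trace.re

/-- `Φ` is smooth on the open set `D` and preserves the Lie-Poisson bracket there. -/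
def IsLiePoissonMapOn {N : ℕ} (D : Set (uLie N)) (Φ : uLie N → uLie N) : Prop :=
  ContDiffOn ℝ ∞ Φ D ∧
  ∀ F G : uLie N → ℝ, ContDiff ℝ ∞ F → ContDiff ℝ ∞ G →
    ∀ Y ∈ D, lpBracket (F ∘ Φ) (G ∘ Φ) Y = lpBracket F G (Φ Y)

end Zeitlin

/-! Everything rests on a factorization. With L = (Δt/2ħ) P(X), the stage equation of the
isospectral integrator reads Y = (1+L) X (1-L), and the update is Y' = (1-L) X (1+L). A midpoint
step with midpoint Ũ and X = Ũ S₀ Ũ* reads U = (1+L) Ũ, U' = (1-L) Ũ. Since L is skew-Hermitian, 1+L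
is invertible with adjoint 1-L. Conjugating S₀ therefore turns midpoint steps into integrator steps,
and Ũ = (1+L)⁻¹ U lifts them back. The Cayley transform (1-L)(1+L)⁻¹ is unitary, which gives both
the Stiefel constraint and isospectrality.

The only facts about P that enter are real linearity, compatibility with the adjoint, and symmetry
for the trace form. The last two follow from T_{ℓ,m}* = (-1)^m T_{ℓ,-m}, a reflection symmetry of
Racah's formula (`racahSum_reflect`).

For the Poisson property, Φ is written as c₋ₕ ∘ cₕ⁻¹ with cₕ = `cayleyMap h`. The gradients of F∘Φ
at Y and of F at Φ(Y) then have the same pullback to the stage, and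
`trace_commutator_eq_of_pullback_eq` shows that such covectors have equal commutator pairings; what
remains cancels because P is symmetric.

For small steps, cₕ is a Lipschitz perturbation of the identity that never decreases the Frobenius
norm, so it has a smooth inverse whose values are the only preimages (`exists_smooth_inverse`).
Second order holds because Φ(Y) - Y = Δt F(X), with F the Zeitlin field, and X agrees with W(Δt/2)
up to O(Δt²) (`exists_local_error_bound`). The best approximation claim is Eckart-Young-Mirsky,
proved by a weighted rearrangement (`sum_tail_le_of_weights`). -/

namespace Zeitlin

/-! ### Conjugation symmetry of the 3j-symbols and of the harmonic matrices -/

/-- The substitution k ↦ k - m permutes the six factorials in the denominator, because j - m = i;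
the shift of the alternating sign is the factor (-1)^m. -/
theorem racahSum_reflect (n l : ℕ) (m : ℤ) (i j : ℕ) (hm : m = (j : ℤ) - i) :
    (-1 : ℝ) ^ m * (∑ k ∈ (Finset.range ((l : ℤ).toNat + 1)).filter (fun k : ℕ =>
        (k : ℤ) ≤ j ∧ (k : ℤ) ≤ l + m ∧ 0 ≤ (n : ℤ) - l - j + (k : ℤ) ∧ 0 ≤ -m + (k : ℤ)),
      (-1 : ℝ) ^ k / (intFact k * intFact ((l : ℤ) - k) * intFact ((j : ℤ) - k) *
          intFact ((l : ℤ) + m - k) * intFact ((n : ℤ) - l - j + k) * intFact (-m + k))) =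
      ∑ k ∈ (Finset.range ((l : ℤ).toNat + 1)).filter (fun k : ℕ =>
        (k : ℤ) ≤ i ∧ (k : ℤ) ≤ l - m ∧ 0 ≤ (n : ℤ) - l - i + (k : ℤ) ∧ 0 ≤ m + (k : ℤ)),
      (-1 : ℝ) ^ k / (intFact k * intFact ((l : ℤ) - k) * intFact ((i : ℤ) - k) *
          intFact ((l : ℤ) - m - k) * intFact ((n : ℤ) - l - i + k) * intFact (m + k)) := by
  rw [Finset.mul_sum]
  refine Finset.sum_nbij' (fun k => ((k : ℤ) - m).toNat) (fun k => ((k : ℤ) + m).toNat)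
    ?_ ?_ ?_ ?_ ?_
  · intro k hk
    simp only [Finset.mem_filter, Finset.mem_range] at hk ⊢
    omega
  · intro k hk
    simp only [Finset.mem_filter, Finset.mem_range] at hk ⊢
    omega
  · intro k hk
    simp only [Finset.mem_filter, Finset.mem_range] at hk ⊢
    omega
  · intro k hk
    simp only [Finset.mem_filter, Finset.mem_range] at hk ⊢
    omega
  · intro k hk
    simp only [Finset.mem_filter, Finset.mem_range] at hk
    have hk' : ((((k : ℤ) - m).toNat : ℕ) : ℤ) = k - m := by omega
    rw [← zpow_natCast (-1 : ℝ) (((k : ℤ) - m).toNat), hk', ← mul_div_assoc,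
      ← zpow_natCast (-1 : ℝ) k, ← zpow_add₀ (by norm_num)]
    have f1 : (l : ℤ) - (k - m) = l + m - k := by ring
    have f2 : (i : ℤ) - (k - m) = j - k := by omega
    have f3 : (l : ℤ) - m - (k - m) = l - k := by ring
    have f4 : (n : ℤ) - l - i + (k - m) = n - l - j + k := by omega
    have f5 : m + ((k : ℤ) - m) = k := by ring
    have f6 : (k : ℤ) - m = -m + k := by ring
    rw [f1, f2, f3, f4, f5, f6]
    have hz : (-1 : ℝ) ^ (m + (k : ℤ)) = (-1) ^ (-m + (k : ℤ)) := by
      have : m + (k : ℤ) = (-m + k) + 2 * m := by ring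
      rw [this, zpow_add₀ (by norm_num), zpow_mul]
      simp
    rw [hz]
    congr 1
    ring

set_option maxHeartbeats 1000000 in
-- Exchanging the outer columns and reversing all projections each cost the same sign, so together
-- they cost none. In Racah's formula the prefactor changes by (-1)^m, which the reflected sum
-- absorbs, and the factorials under the roots are only permuted.
theorem wigner3j_reflect (n l : ℕ) (m : ℤ) (i j : ℕ) (hi : i ≤ n) (hj : j ≤ n) :
    wigner3j n (2 * l) n (-(2 * (j : ℤ) - n)) (2 * m) (2 * (i : ℤ) - n) =
      wigner3j n (2 * l) n (-(2 * (i : ℤ) - n)) (2 * (-m)) (2 * (j : ℤ) - n) := by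
  by_cases hm : m = (j : ℤ) - i
  swap
  · rw [wigner3j, wigner3j, if_neg (by intro h; omega), if_neg (by intro h; omega)]
  unfold wigner3j
  have hc : ((-(2 * (j : ℤ) - n) + 2 * m + (2 * (i : ℤ) - n) = 0 ∧ |-(2 * (j : ℤ) - n)| ≤ (n : ℤ) ∧
      |2 * m| ≤ 2 * (l : ℤ) ∧ |2 * (i : ℤ) - n| ≤ (n : ℤ) ∧ Even ((n : ℤ) + -(2 * (j : ℤ) - n)) ∧
      Even (2 * (l : ℤ) + 2 * m) ∧ Even ((n : ℤ) + (2 * (i : ℤ) - n)) ∧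
      |(n : ℤ) - 2 * l| ≤ (n : ℤ) ∧ (n : ℤ) ≤ (n : ℤ) + 2 * l)) ↔
      (-(2 * (i : ℤ) - n) + 2 * (-m) + (2 * (j : ℤ) - n) = 0 ∧ |-(2 * (i : ℤ) - n)| ≤ (n : ℤ) ∧
      |2 * (-m)| ≤ 2 * (l : ℤ) ∧ |2 * (j : ℤ) - n| ≤ (n : ℤ) ∧ Even ((n : ℤ) + -(2 * (i : ℤ) - n)) ∧
      Even (2 * (l : ℤ) + 2 * (-m)) ∧ Even ((n : ℤ) + (2 * (j : ℤ) - n)) ∧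
      |(n : ℤ) - 2 * l| ≤ (n : ℤ) ∧ (n : ℤ) ≤ (n : ℤ) + 2 * l) := by
    simp only [abs_le, Int.even_iff]
    omega
  by_cases h : (-(2 * (j : ℤ) - n) + 2 * m + (2 * (i : ℤ) - n) = 0 ∧
      |-(2 * (j : ℤ) - n)| ≤ (n : ℤ) ∧
      |2 * m| ≤ 2 * (l : ℤ) ∧ |2 * (i : ℤ) - n| ≤ (n : ℤ) ∧ Even ((n : ℤ) + -(2 * (j : ℤ) - n)) ∧
      Even (2 * (l : ℤ) + 2 * m) ∧ Even ((n : ℤ) + (2 * (i : ℤ) - n)) ∧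
      |(n : ℤ) - 2 * l| ≤ (n : ℤ) ∧ (n : ℤ) ≤ (n : ℤ) + 2 * l)
  swap
  · rw [if_neg h, if_neg (fun h' => h (hc.2 h'))]
  rw [if_pos h, if_pos (hc.1 h)]
  have e1 : ((n : ℤ) - 2 * l - (2 * i - n)) / 2 = n - l - i := by omega
  have e2 : ((n : ℤ) - 2 * l - (2 * j - n)) / 2 = n - l - j := by omega
  have e3 : ((n : ℤ) + 2 * l - n) / 2 = l := by omega
  have e4 : ((n : ℤ) + -(2 * j - n)) / 2 = n - j := by omega
  have e5 : ((n : ℤ) - -(2 * j - n)) / 2 = j := by omega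
  have e6 : ((n : ℤ) + -(2 * i - n)) / 2 = n - i := by omega
  have e7 : ((n : ℤ) - -(2 * i - n)) / 2 = i := by omega
  have e8 : (2 * (l : ℤ) + 2 * m) / 2 = l + m := by omega
  have e9 : (2 * (l : ℤ) - 2 * m) / 2 = l - m := by omega
  have e8' : (2 * (l : ℤ) + 2 * (-m)) / 2 = l - m := by omega
  have e9' : (2 * (l : ℤ) - 2 * (-m)) / 2 = l + m := by omega
  have e10 : ((n : ℤ) + (2 * i - n)) / 2 = i := by omega
  have e11 : ((n : ℤ) - (2 * i - n)) / 2 = n - i := by omega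
  have e12 : ((n : ℤ) + (2 * j - n)) / 2 = j := by omega
  have e13 : ((n : ℤ) - (2 * j - n)) / 2 = n - j := by omega
  have e14 : ((n : ℤ) - 2 * l + -(2 * j - n)) / 2 = n - l - j := by omega
  have e15 : ((n : ℤ) - 2 * l + -(2 * i - n)) / 2 = n - l - i := by omega
  have e16 : ((n : ℤ) - n - 2 * m) / 2 = - m := by omega
  have e17 : ((n : ℤ) - n - 2 * (-m)) / 2 = m := by omega
  rw [e1, e2, e3, e4, e5, e6, e7, e8, e9, e8', e9', e10, e11, e12, e13, e14, e15, e16, e17]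
  have hs : (-1 : ℝ) ^ ((n : ℤ) - l - i) = (-1) ^ ((n : ℤ) - l - j) * (-1) ^ m := by
    rw [← zpow_add₀ (by norm_num), hm]; congr 1; ring
  rw [hs]
  rw [← racahSum_reflect n l m i j hm]
  ring_nf

/-- The entries are real, so the adjoint is the transpose. The 3j-symbols match by reflection, and
the row signs (-1)^(s-m₁) at j and at i differ by (-1)^m. -/
theorem harmonicMatrix_conjTranspose (N l : ℕ) (m : ℤ) :
    (harmonicMatrix N l m)ᴴ = ((-1 : ℂ) ^ m) • harmonicMatrix N l (-m) := by
  ext i j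
  rw [Matrix.conjTranspose_apply, Matrix.smul_apply]
  obtain ⟨n, rfl⟩ : ∃ n, N = n + 1 := ⟨N - 1, by have := i.2; omega⟩
  have hi := i.2
  have hj := j.2
  have hn : (((n + 1 : ℕ) : ℤ) - 1) = n := by push_cast; ring
  by_cases hm : m = (j : ℤ) - i
  swap
  · simp only [harmonicMatrix, Matrix.of_apply, wigner3j]
    rw [if_neg (by intro h; omega), if_neg (by intro h; omega)]
    simp
  simp only [harmonicMatrix, Matrix.of_apply, hn]
  rw [wigner3j_reflect n l m i j (by omega) (by omega)]
  have hs : (-1 : ℝ) ^ (n + 1 - 1 - (j : ℕ)) = (-1) ^ m * (-1) ^ (n + 1 - 1 - (i : ℕ)) := by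
    have e1 : ((n + 1 - 1 - (j : ℕ) : ℕ) : ℤ) = n - j := by omega
    have e2 : ((n + 1 - 1 - (i : ℕ) : ℕ) : ℤ) = n - i := by omega
    have e3 : m + ((n : ℤ) - i) = (n - j) + 2 * m := by omega
    rw [← zpow_natCast, ← zpow_natCast, ← zpow_add₀ (by norm_num), e1, e2, e3,
      zpow_add₀ (by norm_num), zpow_mul]
    simp
  rw [hs]
  simp only [RCLike.star_def, Complex.conj_ofReal, smul_eq_mul]
  push_cast
  ring

/-! ### Spectral operators and the stream matrix -/

theorem spectralOp_add {N : ℕ} (c : ℕ → ℝ) (A B : Matrix (Fin N) (Fin N) ℂ) :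
    spectralOp c (A + B) = spectralOp c A + spectralOp c B := by
  simp only [spectralOp, innerN, Matrix.trace_add, mul_add, add_smul,
    Finset.sum_add_distrib]

theorem spectralOp_smul {N : ℕ} (c : ℕ → ℝ) (a : ℂ) (A : Matrix (Fin N) (Fin N) ℂ) :
    spectralOp c (a • A) = a • spectralOp c A := by
  simp only [spectralOp, innerN, Matrix.mul_smul, Matrix.trace_smul, Finset.smul_sum, smul_smul,
    smul_eq_mul]
  refine Finset.sum_congr rfl fun l _ => Finset.sum_congr rfl fun m _ => ?_
  congr 1
  ring

theorem sum_Icc_neg_comm {M : Type*} [AddCommMonoid M] (l : ℤ) (f : ℤ → M) :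
    ∑ m ∈ Finset.Icc (-l) l, f (-m) = ∑ m ∈ Finset.Icc (-l) l, f m :=
  Finset.sum_nbij' (fun m => -m) (fun m => -m)
    (fun m hm => by simp only [Finset.mem_Icc] at hm ⊢; omega)
    (fun m hm => by simp only [Finset.mem_Icc] at hm ⊢; omega)
    (fun m _ => neg_neg m) (fun m _ => neg_neg m) (fun _ _ => rfl)

theorem neg_one_zpow_mul_self (m : ℤ) : (-1 : ℂ) ^ m * (-1) ^ m = 1 := by
  rw [← mul_zpow]
  simp

theorem star_neg_one_zpow (m : ℤ) : star ((-1 : ℂ) ^ m) = (-1) ^ m := by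
  rw [star_zpow₀]
  simp

/-- Trades the sesquilinear coefficient for a bilinear trace. Since the multiplier depends on ℓ
alone, this and the reindexing m ↦ -m give both symmetries of `spectralOp` below. -/
theorem innerN_harmonicMatrix_neg {N : ℕ} (l : ℕ) (m : ℤ) (A : Matrix (Fin N) (Fin N) ℂ) :
    innerN (harmonicMatrix N l (-m)) A =
      (-1 : ℂ) ^ m * (((4 * Real.pi / N : ℝ) : ℂ) * (harmonicMatrix N l m * A).trace) := by
  have h := congrArg Matrix.conjTranspose (harmonicMatrix_conjTranspose N l m)
  rw [Matrix.conjTranspose_conjTranspose, Matrix.conjTranspose_smul, star_neg_one_zpow] at h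
  rw [h, innerN, Matrix.smul_mul, Matrix.trace_smul, smul_eq_mul]
  linear_combination (-(((4 * Real.pi / N : ℝ) : ℂ) *
    ((harmonicMatrix N l (-m))ᴴ * A).trace)) * neg_one_zpow_mul_self m

/-- The operators `spectralOp c` commute with the conjugate transpose. -/
theorem spectralOp_conjTranspose {N : ℕ} (c : ℕ → ℝ) (A : Matrix (Fin N) (Fin N) ℂ) :
    (spectralOp c A)ᴴ = spectralOp c Aᴴ := by
  simp only [spectralOp, Matrix.conjTranspose_sum]
  refine Finset.sum_congr rfl fun l _ => ?_
  conv_rhs => rw [← sum_Icc_neg_comm]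
  refine Finset.sum_congr rfl fun m _ => ?_
  rw [Matrix.conjTranspose_smul, harmonicMatrix_conjTranspose, innerN_harmonicMatrix_neg, smul_smul,
    innerN]
  have ht : star ((harmonicMatrix N l m)ᴴ * A).trace = (harmonicMatrix N l m * Aᴴ).trace := by
    rw [← Matrix.trace_conjTranspose, Matrix.conjTranspose_mul, Matrix.conjTranspose_conjTranspose,
      Matrix.trace_mul_comm]
  rw [star_mul', star_mul', ht]
  simp only [RCLike.star_def, Complex.conj_ofReal]
  congr 1
  ring

/-- The operators `spectralOp c` are symmetric for the trace form. -/
theorem trace_mul_spectralOp {N : ℕ} (c : ℕ → ℝ) (A B : Matrix (Fin N) (Fin N) ℂ) :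
    (A * spectralOp c B).trace = (spectralOp c A * B).trace := by
  simp only [spectralOp, Finset.mul_sum, Finset.sum_mul, Matrix.trace_sum, Matrix.mul_smul,
    Matrix.smul_mul, Matrix.trace_smul]
  refine Finset.sum_congr rfl fun l _ => ?_
  conv_rhs => rw [← sum_Icc_neg_comm]
  refine Finset.sum_congr rfl fun m _ => ?_
  have h := congrArg (fun M => (M * B).trace) (harmonicMatrix_conjTranspose N l m)
  simp only [Matrix.smul_mul, Matrix.trace_smul, smul_eq_mul] at h
  rw [innerN_harmonicMatrix_neg, innerN, h, Matrix.trace_mul_comm A]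
  simp only [smul_eq_mul]
  ring

theorem streamMatrix_add {N : ℕ} (A B : Matrix (Fin N) (Fin N) ℂ) :
    streamMatrix (A + B) = streamMatrix A + streamMatrix B :=
  spectralOp_add _ A B

theorem streamMatrix_smul {N : ℕ} (a : ℂ) (A : Matrix (Fin N) (Fin N) ℂ) :
    streamMatrix (a • A) = a • streamMatrix A :=
  spectralOp_smul _ a A

theorem streamMatrix_conjTranspose {N : ℕ} (A : Matrix (Fin N) (Fin N) ℂ) :
    (streamMatrix A)ᴴ = streamMatrix Aᴴ :=
  spectralOp_conjTranspose _ A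

theorem trace_mul_streamMatrix {N : ℕ} (A B : Matrix (Fin N) (Fin N) ℂ) :
    (A * streamMatrix B).trace = (streamMatrix A * B).trace :=
  trace_mul_spectralOp _ A B

/-- The stream matrix as a real-linear map. -/
noncomputable def streamLin (N : ℕ) :
    Matrix (Fin N) (Fin N) ℂ →ₗ[ℝ] Matrix (Fin N) (Fin N) ℂ where
  toFun := streamMatrix
  map_add' := streamMatrix_add
  map_smul' a A := by
    have h := streamMatrix_smul (a : ℂ) A
    simpa only [Complex.coe_smul, RingHom.id_apply] using h

theorem streamMatrix_neg {N : ℕ} (A : Matrix (Fin N) (Fin N) ℂ) :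
    streamMatrix (-A) = -streamMatrix A :=
  map_neg (streamLin N) A

/-- The stream matrix of a skew-Hermitian matrix is skew-Hermitian. -/
theorem streamMatrix_skew {N : ℕ} {A : Matrix (Fin N) (Fin N) ℂ} (hA : Aᴴ = -A) :
    (streamMatrix A)ᴴ = -streamMatrix A := by
  rw [streamMatrix_conjTranspose, hA, streamMatrix_neg]

/-! ### Cayley form of the two schemes -/

open scoped ComplexOrder in
-- The product (1-L)(1+L) = 1 + L*L is positive definite, so no smallness of the step is needed.
theorem isUnit_one_add_of_skew {n : Type*} [Fintype n] [DecidableEq n] {L : Matrix n n ℂ}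
    (hL : Lᴴ = -L) : IsUnit (1 + L) := by
  have h : ((1 - L) * (1 + L)) = 1 + Lᴴ * L := by
    rw [hL]; noncomm_ring
  have hp : (1 + Lᴴ * L).PosDef :=
    Matrix.PosDef.one.add_posSemidef (Matrix.posSemidef_conjTranspose_mul_self L)
  rw [Matrix.isUnit_iff_isUnit_det]
  have hd := (Matrix.isUnit_iff_isUnit_det _).1 hp.isUnit
  rw [← h, Matrix.det_mul] at hd
  exact isUnit_of_mul_isUnit_right hd

/-- The generator `(Δt / 2ħ) P(X)` of the Cayley transform in a step with stage `X`. -/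
noncomputable def stepGen {N : ℕ} (Δt : ℝ) (X : Matrix (Fin N) (Fin N) ℂ) :
    Matrix (Fin N) (Fin N) ℂ :=
  (Δt / (2 * hbar N)) • streamMatrix X

theorem stepGen_skew {N : ℕ} (Δt : ℝ) {X : Matrix (Fin N) (Fin N) ℂ} (hX : Xᴴ = -X) :
    (stepGen Δt X)ᴴ = -stepGen Δt X := by
  rw [stepGen, Matrix.conjTranspose_smul, streamMatrix_skew hX, smul_neg]
  simp

theorem isoStageMap_eq {N : ℕ} (Δt : ℝ) (W X : Matrix (Fin N) (Fin N) ℂ) :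
    isoStageMap Δt W X = W - (stepGen Δt X * X - X * stepGen Δt X) +
      stepGen Δt X * X * stepGen Δt X := by
  simp only [isoStageMap, stepGen, commN, Matrix.smul_mul, Matrix.mul_smul, smul_smul, ← smul_sub]
  congr 3 <;> ring

/-- Expanding (1+L) X (1-L) gives X plus the commutator minus LXL, which is the stage equation
solved for W. -/
theorem isIsoStep_iff {N : ℕ} (Δt : ℝ) (W X W' : Matrix (Fin N) (Fin N) ℂ) :
    IsIsoStep Δt W X W' ↔ Xᴴ = -X ∧ W = (1 + stepGen Δt X) * X * (1 - stepGen Δt X) ∧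
      W' = (1 - stepGen Δt X) * X * (1 + stepGen Δt X) := by
  rw [IsIsoStep, skewAdjoint.mem_iff, Matrix.star_eq_conjTranspose]
  refine and_congr Iff.rfl (and_congr ?_ Iff.rfl)
  rw [isoStageMap_eq]
  have h : (1 + stepGen Δt X) * X * (1 - stepGen Δt X) =
      X + (stepGen Δt X * X - X * stepGen Δt X) - stepGen Δt X * X * stepGen Δt X := by
    noncomm_ring
  rw [h]
  constructor
  · intro h1
    nth_rw 1 [h1]
    abel
  · intro h1
    rw [h1]
    abel

/-- The increment is -2LŨ, so the endpoints are symmetric about Ũ. With the midpoint as a variable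
the implicit scheme becomes a pair of explicit formulas. -/
theorem isMidpointStep_iff {N r : ℕ} (S : Matrix (Fin r) (Fin r) ℂ) (Δt : ℝ)
    (U U' Ut : Matrix (Fin N) (Fin r) ℂ) :
    IsMidpointStep (reconField S) Δt U U' ∧ Ut = (1 / 2 : ℝ) • (U' + U) ↔
      U = (1 + stepGen Δt (Ut * S * Utᴴ)) * Ut ∧ U' = (1 - stepGen Δt (Ut * S * Utᴴ)) * Ut := by
  have hf : Δt • reconField S Ut = (-2 : ℝ) • (stepGen Δt (Ut * S * Utᴴ) * Ut) := by
    rw [reconField, stepGen, Matrix.smul_mul, smul_neg, smul_smul, smul_smul, ← neg_smul]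
    congr 1
    rw [mul_comm 2 (hbar N), ← div_div]
    ring
  rw [Matrix.add_mul, Matrix.sub_mul, Matrix.one_mul]
  constructor
  · rintro ⟨h1, h2⟩
    rw [IsMidpointStep, ← h2, hf] at h1
    generalize stepGen Δt (Ut * S * Utᴴ) * Ut = A at h1
    subst h2
    have h3 : U' = U + (-2 : ℝ) • A := by rw [← h1]; abel
    subst h3
    constructor <;> module
  · rintro ⟨h1, h2⟩
    have h3 : Ut = (1 / 2 : ℝ) • (U' + U) := by
      rw [h1, h2]
      generalize stepGen Δt (Ut * S * Utᴴ) * Ut = A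
      module
    refine ⟨?_, h3⟩
    rw [IsMidpointStep, ← h3, hf, h1, h2]
    generalize stepGen Δt (Ut * S * Utᴴ) * Ut = A
    module

theorem conjTranspose_conj_skew {m n : Type*} [Fintype n] {S : Matrix n n ℂ} (hS : Sᴴ = -S)
    (U : Matrix m n ℂ) : (U * S * Uᴴ)ᴴ = -(U * S * Uᴴ) := by
  rw [Matrix.conjTranspose_mul, Matrix.conjTranspose_mul, Matrix.conjTranspose_conjTranspose, hS,
    Matrix.neg_mul, Matrix.mul_neg, Matrix.mul_assoc]

theorem conjTranspose_one_add_skew {n : Type*} [Fintype n] [DecidableEq n] {L : Matrix n n ℂ}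
    (hL : Lᴴ = -L) : (1 + L)ᴴ = 1 - L := by
  rw [Matrix.conjTranspose_add, Matrix.conjTranspose_one, hL, sub_eq_add_neg]

theorem conjTranspose_one_sub_skew {n : Type*} [Fintype n] [DecidableEq n] {L : Matrix n n ℂ}
    (hL : Lᴴ = -L) : (1 - L)ᴴ = 1 + L := by
  rw [Matrix.conjTranspose_sub, Matrix.conjTranspose_one, hL, sub_neg_eq_add]

theorem one_add_mul_one_sub_comm {R : Type*} [Ring R] (L : R) :
    (1 + L) * (1 - L) = (1 - L) * (1 + L) := by noncomm_ring

/-- The implicit midpoint rule for the reconstruction equation preserves the Stiefel manifold. -/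
theorem IsMidpointStep.mem_stiefel {N r : ℕ} {S : Matrix (Fin r) (Fin r) ℂ} (hS : Sᴴ = -S)
    {Δt : ℝ} {U U' : Matrix (Fin N) (Fin r) ℂ} (hU : U ∈ stiefel N r)
    (h : IsMidpointStep (reconField S) Δt U U') : U' ∈ stiefel N r := by
  obtain ⟨h1, h2⟩ := (isMidpointStep_iff S Δt U U' _).1 ⟨h, rfl⟩
  generalize (1 / 2 : ℝ) • (U' + U) = Ut at h1 h2
  have hL := stepGen_skew Δt (conjTranspose_conj_skew hS Ut)
  generalize stepGen Δt (Ut * S * Utᴴ) = L at h1 h2 hL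
  -- Both Gram matrices are Ũ* (1-L)(1+L) Ũ, up to the order of the commuting factors.
  have e : U'ᴴ * U' = Uᴴ * U := by
    rw [h1, h2, Matrix.conjTranspose_mul, Matrix.conjTranspose_mul, conjTranspose_one_add_skew hL,
      conjTranspose_one_sub_skew hL, Matrix.mul_assoc, Matrix.mul_assoc, ← Matrix.mul_assoc (1 + L),
      ← Matrix.mul_assoc (1 - L), one_add_mul_one_sub_comm]
  exact e.trans hU

/-- Steps of the midpoint rule descend to steps of the isospectral integrator. -/
theorem isIsoStep_of_midpoint {N r : ℕ} {S : Matrix (Fin r) (Fin r) ℂ} (hS : Sᴴ = -S)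
    {Δt : ℝ} {U U' Ut : Matrix (Fin N) (Fin r) ℂ}
    (h : IsMidpointStep (reconField S) Δt U U') (ht : Ut = (1 / 2 : ℝ) • (U' + U)) :
    IsIsoStep Δt (U * S * Uᴴ) (Ut * S * Utᴴ) (U' * S * U'ᴴ) := by
  obtain ⟨h1, h2⟩ := (isMidpointStep_iff S Δt U U' Ut).1 ⟨h, ht⟩
  have hX := conjTranspose_conj_skew hS Ut
  refine (isIsoStep_iff _ _ _ _).2 ⟨hX, ?_, ?_⟩
  · have hL := stepGen_skew Δt hX
    generalize stepGen Δt (Ut * S * Utᴴ) = L at h1 hL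
    rw [h1, Matrix.conjTranspose_mul, conjTranspose_one_add_skew hL]
    simp only [Matrix.mul_assoc]
  · have hL := stepGen_skew Δt hX
    generalize stepGen Δt (Ut * S * Utᴴ) = L at h2 hL
    rw [h2, Matrix.conjTranspose_mul, conjTranspose_one_sub_skew hL]
    simp only [Matrix.mul_assoc]

/-- Steps of the isospectral integrator lift to steps of the midpoint rule. -/
theorem IsIsoStep.exists_midpoint {N r : ℕ} {S : Matrix (Fin r) (Fin r) ℂ}
    {Δt : ℝ} {U : Matrix (Fin N) (Fin r) ℂ} {X Y' : Matrix (Fin N) (Fin N) ℂ}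
    (h : IsIsoStep Δt (U * S * Uᴴ) X Y') :
    ∃ U' Ut : Matrix (Fin N) (Fin r) ℂ, IsMidpointStep (reconField S) Δt U U' ∧
      Ut = (1 / 2 : ℝ) • (U' + U) ∧ X = Ut * S * Utᴴ ∧ Y' = U' * S * U'ᴴ := by
  obtain ⟨hX, h1, h2⟩ := (isIsoStep_iff _ _ _ _).1 h
  have hL := stepGen_skew Δt hX
  set L := stepGen Δt X with hLdef
  obtain ⟨u, hu⟩ := isUnit_one_add_of_skew hL
  set B : Matrix (Fin N) (Fin N) ℂ := ↑u⁻¹ with hB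
  have hB1 : (1 + L) * B = 1 := by rw [← hu]; exact u.mul_inv
  have hB2 : B * (1 + L) = 1 := by rw [← hu]; exact u.inv_mul
  have hB3 : (1 - L) * Bᴴ = 1 := by
    rw [← conjTranspose_one_add_skew hL, ← Matrix.conjTranspose_mul, hB2, Matrix.conjTranspose_one]
  -- With BU as midpoint, the induced stage is X again; hence the generator in the midpoint
  -- equations is the given L.
  have hXe : X = (B * U) * S * (B * U)ᴴ := by
    calc X = (B * (1 + L)) * X * ((1 - L) * Bᴴ) := by rw [hB2, hB3, one_mul, mul_one]
      _ = B * ((1 + L) * X * (1 - L)) * Bᴴ := by simp only [Matrix.mul_assoc]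
      _ = _ := by rw [← h1, Matrix.conjTranspose_mul]; simp only [Matrix.mul_assoc]
  have hm := (isMidpointStep_iff S Δt U ((1 - L) * (B * U)) (B * U)).2 (by
    rw [← hXe, ← hLdef, ← Matrix.mul_assoc, hB1, Matrix.one_mul]
    exact ⟨rfl, rfl⟩)
  refine ⟨_, _, hm.1, hm.2, hXe, ?_⟩
  rw [h2, hXe, Matrix.conjTranspose_mul (1 - L), conjTranspose_one_sub_skew hL]
  simp only [Matrix.mul_assoc]

/-- A midpoint step is determined by its initial value and the stage it induces. -/
theorem IsMidpointStep.unique_of_stage {N r : ℕ} {S : Matrix (Fin r) (Fin r) ℂ} (hS : Sᴴ = -S)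
    {Δt : ℝ} {U U₁ U₂ T₁ T₂ : Matrix (Fin N) (Fin r) ℂ}
    (h₁ : IsMidpointStep (reconField S) Δt U U₁) (ht₁ : T₁ = (1 / 2 : ℝ) • (U₁ + U))
    (h₂ : IsMidpointStep (reconField S) Δt U U₂) (ht₂ : T₂ = (1 / 2 : ℝ) • (U₂ + U))
    (hT : T₁ * S * T₁ᴴ = T₂ * S * T₂ᴴ) : U₁ = U₂ := by
  obtain ⟨a1, b1⟩ := (isMidpointStep_iff S Δt U U₁ T₁).1 ⟨h₁, ht₁⟩
  obtain ⟨a2, b2⟩ := (isMidpointStep_iff S Δt U U₂ T₂).1 ⟨h₂, ht₂⟩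
  rw [← hT] at a2 b2
  have hL := stepGen_skew Δt (conjTranspose_conj_skew hS T₁)
  generalize stepGen Δt (T₁ * S * T₁ᴴ) = L at *
  obtain ⟨u, hu⟩ := isUnit_one_add_of_skew hL
  -- Equal stages give the same L, and 1+L can be cancelled in U = (1+L)T₁ = (1+L)T₂.
  have hTT : T₁ = T₂ := by
    have e := congrArg (fun A => (↑u⁻¹ : Matrix (Fin N) (Fin N) ℂ) * A) (a1.symm.trans a2)
    simpa only [← hu, ← Matrix.mul_assoc, u.inv_mul, Matrix.one_mul] using e
  rw [b1, b2, hTT]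

/-! ### Coadjoint orbits and trajectories -/

theorem coadjointOrbit_self {N : ℕ} (Y : Matrix (Fin N) (Fin N) ℂ) : Y ∈ coadjointOrbit Y :=
  ⟨1, one_mem _, by simp⟩

theorem coadjointOrbit_trans {N : ℕ} {X Y Z : Matrix (Fin N) (Fin N) ℂ}
    (h₁ : Y ∈ coadjointOrbit X) (h₂ : Z ∈ coadjointOrbit Y) : Z ∈ coadjointOrbit X := by
  obtain ⟨R, hR, rfl⟩ := h₁
  obtain ⟨Q, hQ, rfl⟩ := h₂
  refine ⟨Q * R, mul_mem hQ hR, ?_⟩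
  rw [Matrix.conjTranspose_mul]
  simp only [Matrix.mul_assoc]

/-- The isospectral integrator preserves the coadjoint orbits. -/
theorem IsIsoStep.mem_coadjointOrbit {N : ℕ} {Δt : ℝ} {Y X Y' : Matrix (Fin N) (Fin N) ℂ}
    (h : IsIsoStep Δt Y X Y') : Y' ∈ coadjointOrbit Y := by
  obtain ⟨hX, h1, h2⟩ := (isIsoStep_iff _ _ _ _).1 h
  have hL := stepGen_skew Δt hX
  generalize stepGen Δt X = L at *
  obtain ⟨u, hu⟩ := isUnit_one_add_of_skew hL
  set B : Matrix (Fin N) (Fin N) ℂ := ↑u⁻¹ with hB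
  have hB1 : (1 + L) * B = 1 := by rw [← hu]; exact u.mul_inv
  have hB2 : B * (1 + L) = 1 := by rw [← hu]; exact u.inv_mul
  have hB3 : (1 - L) * Bᴴ = 1 := by
    rw [← conjTranspose_one_add_skew hL, ← Matrix.conjTranspose_mul, hB2, Matrix.conjTranspose_one]
  have hB4 : Bᴴ * (1 - L) = 1 := by
    rw [← conjTranspose_one_add_skew hL, ← Matrix.conjTranspose_mul, hB1, Matrix.conjTranspose_one]
  have hR : ((1 - L) * B)ᴴ = Bᴴ * (1 + L) := by
    rw [Matrix.conjTranspose_mul, conjTranspose_one_sub_skew hL]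
  -- The conjugating unitary is the Cayley transform (1-L)(1+L)⁻¹.
  refine ⟨(1 - L) * B, ?_, ?_⟩
  · rw [Matrix.mem_unitaryGroup_iff', Matrix.star_eq_conjTranspose, hR]
    calc Bᴴ * (1 + L) * ((1 - L) * B) = Bᴴ * ((1 + L) * (1 - L)) * B := by
          simp only [Matrix.mul_assoc]
      _ = (Bᴴ * (1 - L)) * ((1 + L) * B) := by
          rw [one_add_mul_one_sub_comm]; simp only [Matrix.mul_assoc]
      _ = 1 := by rw [hB4, hB1, one_mul]
  · rw [hR, h1, h2]
    calc (1 - L) * X * (1 + L) = (1 - L) * (B * (1 + L)) * X * (((1 - L) * Bᴴ) * (1 + L)) := by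
          rw [hB2, hB3, one_mul, mul_one]
      _ = _ := by simp only [Matrix.mul_assoc]

theorem midpoint_trajectory {N r : ℕ} {S : Matrix (Fin r) (Fin r) ℂ} (hS : Sᴴ = -S) {Δt : ℝ}
    {n : ℕ} {U : ℕ → Matrix (Fin N) (Fin r) ℂ} (h0 : U 0 ∈ stiefel N r)
    (h : ∀ τ < n, IsMidpointStep (reconField S) Δt (U τ) (U (τ + 1))) :
    ∀ τ ≤ n, U τ ∈ stiefel N r ∧ U τ * S * (U τ)ᴴ ∈ coadjointOrbit (U 0 * S * (U 0)ᴴ) := by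
  intro τ
  induction τ with
  | zero => exact fun _ => ⟨h0, coadjointOrbit_self _⟩
  | succ k ih =>
    intro hk
    obtain ⟨h1, h2⟩ := ih (by omega)
    have hs := h k (by omega)
    exact ⟨hs.mem_stiefel hS h1,
      coadjointOrbit_trans h2 (isIsoStep_of_midpoint hS hs rfl).mem_coadjointOrbit⟩

/-- A trajectory of the isospectral integrator lifts to a trajectory of the midpoint rule. -/
theorem exists_midpoint_trajectory {N r : ℕ} {S : Matrix (Fin r) (Fin r) ℂ} {Δt : ℝ}
    (U₀ : Matrix (Fin N) (Fin r) ℂ) {Y : ℕ → Matrix (Fin N) (Fin N) ℂ}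
    (h0 : Y 0 = U₀ * S * U₀ᴴ) (n : ℕ) (h : ∀ τ < n, ∃ X, IsIsoStep Δt (Y τ) X (Y (τ + 1))) :
    ∃ U : ℕ → Matrix (Fin N) (Fin r) ℂ, U 0 = U₀ ∧
      (∀ τ < n, IsMidpointStep (reconField S) Δt (U τ) (U (τ + 1))) ∧
      ∀ τ ≤ n, Y τ = U τ * S * (U τ)ᴴ := by
  induction n with
  | zero =>
    refine ⟨fun _ => U₀, rfl, fun τ hτ => absurd hτ (by omega), fun τ hτ => ?_⟩
    obtain rfl : τ = 0 := by omega
    exact h0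
  | succ k ih =>
    obtain ⟨U, hU0, hU1, hU2⟩ := ih fun τ hτ => h τ (by omega)
    obtain ⟨X, hX⟩ := h k (by omega)
    rw [hU2 k le_rfl] at hX
    obtain ⟨U', _, h1, -, -, h2⟩ := hX.exists_midpoint
    refine ⟨Function.update U (k + 1) U', ?_, fun τ hτ => ?_, fun τ hτ => ?_⟩
    · rw [Function.update_of_ne (by omega), hU0]
    · rw [Function.update_of_ne (by omega)]
      rcases Nat.lt_or_ge τ k with hlt | hge
      · rw [Function.update_of_ne (by omega)]
        exact hU1 τ hlt
      · obtain rfl : τ = k := by omega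
        rw [Function.update_self]
        exact h1
    · rcases Nat.lt_or_ge τ (k + 1) with hlt | hge
      · rw [Function.update_of_ne (by omega)]
        exact hU2 τ (by omega)
      · obtain rfl : τ = k + 1 := by omega
        rw [Function.update_self]
        exact h2

/-! ### Eckart-Young-Mirsky in the Frobenius norm -/

theorem trace_conjTranspose_mul_self_re {m n : Type*} [Fintype m] [Fintype n] (A : Matrix m n ℂ) :
    (Aᴴ * A).trace.re = ∑ j, ∑ i, ‖A i j‖ ^ 2 := by
  simp only [Matrix.trace, Matrix.diag_apply, Matrix.mul_apply, Matrix.conjTranspose_apply,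
    RCLike.star_def, Complex.re_sum, ← Complex.normSq_eq_conj_mul_self, Complex.ofReal_re,
    Complex.normSq_eq_norm_sq]

theorem trace_conjTranspose_mul_self_re_nonneg {m n : Type*} [Fintype m] [Fintype n]
    (A : Matrix m n ℂ) : 0 ≤ (Aᴴ * A).trace.re := by
  rw [trace_conjTranspose_mul_self_re]
  positivity

/-- This is the trace of the projection, computed by applying Parseval in a basis of K and then in
e. -/
theorem sum_norm_sq_orthogonalProjectionOnto {ι E : Type*} [Fintype ι] [NormedAddCommGroup E]
    [InnerProductSpace ℂ E] [FiniteDimensional ℂ E] (e : OrthonormalBasis ι ℂ E)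
    (K : Submodule ℂ E) :
    ∑ j, ‖K.orthogonalProjectionOnto (e j)‖ ^ 2 = Module.finrank ℂ K := by
  have b := stdOrthonormalBasis ℂ K
  calc ∑ j, ‖K.orthogonalProjectionOnto (e j)‖ ^ 2
      = ∑ j, ∑ k, ‖inner ℂ (b k : E) (e j)‖ ^ 2 := by
        refine Finset.sum_congr rfl fun j _ => ?_
        rw [← b.sum_sq_norm_inner_right]
        simp only [Submodule.inner_orthogonalProjectionOnto_eq_of_mem_left]
    _ = ∑ k, ‖b k‖ ^ 2 := by
        rw [Finset.sum_comm]
        refine Finset.sum_congr rfl fun k _ => ?_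
        rw [e.sum_sq_norm_inner_left, Submodule.coe_norm]
    _ = _ := by simp [b.norm_eq_one]

/-- By Pythagoras the left side is the squared norm of the component of x in Kᗮ, which subtracting z
∈ K does not change. -/
theorem norm_sq_sub_le_of_mem {E : Type*} [NormedAddCommGroup E] [InnerProductSpace ℂ E]
    (K : Submodule ℂ E) [K.HasOrthogonalProjection] (x z : E) (hz : z ∈ K) :
    ‖x‖ ^ 2 - ‖K.orthogonalProjectionOnto x‖ ^ 2 ≤ ‖x - z‖ ^ 2 := by
  rw [K.norm_sq_eq_add_norm_sq_projection (x := x), K.norm_sq_eq_add_norm_sq_projection (x := x - z),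
    map_sub Kᗮ.orthogonalProjectionOnto,
    Submodule.orthogonalProjectionOnto_orthogonal_apply_eq_zero hz, sub_zero]
  nlinarith [sq_nonneg ‖K.orthogonalProjectionOnto (x - z)‖]

/-- Bathtub principle: weights in [0,1] of total mass at most r capture the most when they sit on
the r largest values. A threshold c between the head and the tail gives the inequality termwise,
with surplus c (r - ∑ q) ≥ 0. -/
theorem sum_tail_le_of_weights {N r : ℕ} (hr : r ≤ N) (a q : Fin N → ℝ) (ha : ∀ i, 0 ≤ a i)
    (hq0 : ∀ i, 0 ≤ q i) (hq1 : ∀ i, q i ≤ 1) (hq : ∑ i, q i ≤ r)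
    (hs : ∀ i j : Fin N, (i : ℕ) < r → r ≤ (j : ℕ) → a j ≤ a i) :
    ∑ j : Fin N, (if (j : ℕ) < r then 0 else a j) ≤ ∑ j, a j * (1 - q j) := by
  obtain ⟨c, hc0, hc1, hc2⟩ : ∃ c : ℝ, 0 ≤ c ∧ (∀ i : Fin N, (i : ℕ) < r → c ≤ a i) ∧
      (0 < r → ∀ j : Fin N, r ≤ (j : ℕ) → a j ≤ c) := by
    rcases Nat.eq_zero_or_pos r with h0 | h0
    -- For r = 0 the value of c is a dummy: all weights vanish and the claim is proved separately.
    · exact ⟨0, le_rfl, fun i hi => by omega, fun h => by omega⟩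
    · obtain ⟨i0, hi0, hmin⟩ := Finset.exists_min_image
        (Finset.univ.filter fun i : Fin N => (i : ℕ) < r) a ⟨⟨0, by omega⟩, by simpa using h0⟩
      simp only [Finset.mem_filter, Finset.mem_univ, true_and] at hi0 hmin
      exact ⟨a i0, ha _, hmin, fun _ j hj => hs i0 j hi0 hj⟩
  have hcount : ∑ j : Fin N, (if (j : ℕ) < r then (1 : ℝ) else 0) = r := by
    rw [Finset.sum_boole, Fin.card_filter_val_lt, min_eq_right hr]
  rcases Nat.eq_zero_or_pos r with h0 | h0
  · subst h0
    have hq' : ∀ i, q i = 0 := fun i =>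
      (Finset.sum_eq_zero_iff_of_nonneg fun i _ => hq0 i).1
        (le_antisymm (by simpa using hq) (Finset.sum_nonneg fun i _ => hq0 i)) i (Finset.mem_univ i)
    simp [hq']
  have key : ∑ j : Fin N, c * ((if (j : ℕ) < r then (1 : ℝ) else 0) - q j) ≤
      ∑ j : Fin N, (a j * (1 - q j) - if (j : ℕ) < r then 0 else a j) := by
    refine Finset.sum_le_sum fun j _ => ?_
    by_cases hj : (j : ℕ) < r
    · rw [if_pos hj, if_pos hj]
      nlinarith [hc1 j hj, hq1 j]
    · rw [if_neg hj, if_neg hj]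
      nlinarith [hc2 h0 j (by omega), hq0 j]
  rw [← Finset.mul_sum, Finset.sum_sub_distrib, Finset.sum_sub_distrib, hcount] at key
  nlinarith [mul_nonneg hc0 (sub_nonneg.2 hq)]

/-- The Eckart-Young-Mirsky bound for a diagonal matrix in the Frobenius norm. -/
theorem frobNorm_diagonal_tail_le {N r : ℕ} (hr : r ≤ N) (μ : Fin N → ℂ)
    (hμ : ∀ i j : Fin N, (i : ℕ) < r → r ≤ (j : ℕ) → ‖μ j‖ ≤ ‖μ i‖)
    (Z : Matrix (Fin N) (Fin N) ℂ) (hZ : Z.rank ≤ r) :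
    frobNorm (Matrix.diagonal fun i : Fin N => if (i : ℕ) < r then 0 else μ i) ≤
      frobNorm (Matrix.diagonal μ - Z) := by
  refine Real.sqrt_le_sqrt ?_
  let e := EuclideanSpace.basisFun (Fin N) ℂ
  let K := LinearMap.range (Matrix.toEuclideanLin Z)
  have hK : Module.finrank ℂ K ≤ r := by
    have h := Matrix.rank_eq_finrank_range_toLin Z (PiLp.basisFun 2 ℂ (Fin N))
      (PiLp.basisFun 2 ℂ (Fin N))
    rw [← Matrix.toLpLin_eq_toLin] at h
    exact h.symm.le.trans hZ
  have h1 : ∑ j : Fin N, (if (j : ℕ) < r then 0 else ‖μ j‖ ^ 2) ≤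
      ∑ j, ‖μ j‖ ^ 2 * (1 - ‖K.orthogonalProjectionOnto (e j)‖ ^ 2) := by
    refine sum_tail_le_of_weights hr _ _ (fun i => sq_nonneg _) (fun i => sq_nonneg _) ?_ ?_ ?_
    · intro i
      have h := K.norm_sq_eq_add_norm_sq_projection (x := e i)
      rw [e.norm_eq_one] at h
      nlinarith [sq_nonneg ‖Kᗮ.orthogonalProjectionOnto (e i)‖]
    · rw [sum_norm_sq_orthogonalProjectionOnto]
      exact_mod_cast hK
    · intro i j hi hj
      have := hμ i j hi hj
      gcongr
  have h2 : ((Matrix.diagonal fun i : Fin N => if (i : ℕ) < r then 0 else μ i)ᴴ *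
      (Matrix.diagonal fun i : Fin N => if (i : ℕ) < r then 0 else μ i)).trace.re =
      ∑ j : Fin N, (if (j : ℕ) < r then 0 else ‖μ j‖ ^ 2) := by
    rw [trace_conjTranspose_mul_self_re]
    refine Finset.sum_congr rfl fun j _ => ?_
    rw [Finset.sum_eq_single j]
    · by_cases hj : (j : ℕ) < r <;> simp [hj]
    · intro i _ hij
      rw [Matrix.diagonal_apply_ne _ hij]
      simp
    · simp
  rw [h2, trace_conjTranspose_mul_self_re]
  refine h1.trans (Finset.sum_le_sum fun j _ => ?_)
  -- Column j of the difference is μ_j e_j - Z e_j, whose second term lies in the range K of Z. The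
  -- weights are ‖P_K e_j‖², of total mass dim K ≤ r.
  have h3 := norm_sq_sub_le_of_mem K (μ j • e j) (Matrix.toEuclideanLin Z (e j)) ⟨_, rfl⟩
  rw [map_smul, norm_smul, norm_smul, e.norm_eq_one, mul_one, EuclideanSpace.norm_sq_eq] at h3
  calc _ = ‖μ j‖ ^ 2 - (‖μ j‖ * ‖K.orthogonalProjectionOnto (e j)‖) ^ 2 := by ring
    _ ≤ _ := h3
    _ = _ := by
      refine Finset.sum_congr rfl fun i _ => ?_
      congr 2
      simp [e, Matrix.toLpLin_apply, Matrix.diagonal_apply]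
      split_ifs with hij <;> simp [*]

theorem frobNorm_unitary_conj {N : ℕ} {V : Matrix (Fin N) (Fin N) ℂ} (hV : Vᴴ * V = 1)
    (A : Matrix (Fin N) (Fin N) ℂ) : frobNorm (V * A * Vᴴ) = frobNorm A := by
  have h : ((V * A * Vᴴ)ᴴ * (V * A * Vᴴ)).trace = (Aᴴ * A).trace := by
    rw [Matrix.conjTranspose_mul, Matrix.conjTranspose_mul, Matrix.conjTranspose_conjTranspose]
    calc (V * (Aᴴ * Vᴴ) * (V * A * Vᴴ)).trace = (V * (Aᴴ * (Vᴴ * V) * A * Vᴴ)).trace := by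
          simp only [Matrix.mul_assoc]
      _ = (Aᴴ * A * (Vᴴ * V)).trace := by
          rw [Matrix.trace_mul_comm, hV]; simp only [Matrix.mul_assoc, hV, Matrix.mul_one]
      _ = _ := by rw [hV, Matrix.mul_one]
  rw [frobNorm, frobNorm, h]

namespace IsLeadingEigen

variable {N r : ℕ} {hr : r ≤ N} {W₀ : Matrix (Fin N) (Fin N) ℂ} {U₀ : Matrix (Fin N) (Fin r) ℂ}
  {S₀ : Matrix (Fin r) (Fin r) ℂ}

theorem mem_stiefel (h : IsLeadingEigen hr W₀ U₀ S₀) : U₀ ∈ stiefel N r := by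
  obtain ⟨V, hV, μ, -, -, rfl, -⟩ := h
  have hV' : Vᴴ * V = 1 := Matrix.mem_unitaryGroup_iff'.1 hV
  have e : (V.submatrix id (Fin.castLE hr))ᴴ * V.submatrix id (Fin.castLE hr) =
      (Vᴴ * V).submatrix (Fin.castLE hr) (Fin.castLE hr) := rfl
  rw [stiefel, Set.mem_ofPred_eq, e, hV']
  exact Matrix.submatrix_one _ (Fin.castLE_injective hr)

theorem conjTranspose_eq_neg (h : IsLeadingEigen hr W₀ U₀ S₀) (hW : W₀ᴴ = -W₀) : S₀ᴴ = -S₀ := by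
  obtain ⟨V, hV, μ, rfl, -, -, rfl⟩ := h
  have hV' : Vᴴ * V = 1 := Matrix.mem_unitaryGroup_iff'.1 hV
  have hD : (Matrix.diagonal μ)ᴴ = -Matrix.diagonal μ := by
    have e : ∀ A : Matrix (Fin N) (Fin N) ℂ, Vᴴ * (V * A * Vᴴ) * V = A := fun A => by
      calc Vᴴ * (V * A * Vᴴ) * V = (Vᴴ * V) * A * (Vᴴ * V) := by simp only [Matrix.mul_assoc]
        _ = A := by rw [hV', Matrix.one_mul, Matrix.mul_one]
    have h1 := congrArg (fun A => Vᴴ * A * V) hW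
    simp only [Matrix.conjTranspose_mul, Matrix.conjTranspose_conjTranspose] at h1
    rw [← Matrix.mul_assoc V, e, Matrix.mul_neg, Matrix.neg_mul, e] at h1
    exact h1
  rw [Matrix.diagonal_conjTranspose, Matrix.diagonal_neg] at hD ⊢
  have hμ := Matrix.diagonal_injective hD
  congr 1
  funext i
  exact congrFun hμ (Fin.castLE hr i)

/-- The projection of `W₀` to its `r` leading eigenvectors is a best approximation of rank at
most `r`. -/
theorem isBestRankApprox (h : IsLeadingEigen hr W₀ U₀ S₀) :
    IsBestRankApprox r W₀ (U₀ * S₀ * U₀ᴴ) := by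
  obtain ⟨V, hV, μ, rfl, hμ, rfl, rfl⟩ := h
  have hV' : Vᴴ * V = 1 := Matrix.mem_unitaryGroup_iff'.1 hV
  have hV'' : V * Vᴴ = 1 := Matrix.mem_unitaryGroup_iff.1 hV
  constructor
  · rw [Matrix.mul_assoc]
    refine (Matrix.rank_mul_le_left _ _).trans ((Matrix.rank_le_width _))
  intro Z hZ
  have hY : V.submatrix id (Fin.castLE hr) * Matrix.diagonal (fun i => μ (Fin.castLE hr i)) *
      (V.submatrix id (Fin.castLE hr))ᴴ =
      V * Matrix.diagonal (fun i : Fin N => if (i : ℕ) < r then μ i else 0) * Vᴴ := by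
    ext a b
    rw [Matrix.mul_apply, Matrix.mul_apply]
    simp only [Matrix.mul_diagonal]
    refine Fintype.sum_of_injective (Fin.castLE hr) (Fin.castLE_injective hr) _ _ ?_ ?_
    · intro i hi
      rw [if_neg, mul_zero, zero_mul]
      exact fun h => hi ⟨⟨i, h⟩, rfl⟩
    · intro i
      rw [if_pos (by simp)]
      rfl
  have e1 : V * Matrix.diagonal μ * Vᴴ - V.submatrix id (Fin.castLE hr) *
      Matrix.diagonal (fun i => μ (Fin.castLE hr i)) * (V.submatrix id (Fin.castLE hr))ᴴ =
      V * (Matrix.diagonal fun i : Fin N => if (i : ℕ) < r then 0 else μ i) * Vᴴ := by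
    rw [hY, ← Matrix.sub_mul, ← Matrix.mul_sub, Matrix.diagonal_sub]
    congr 4
    funext i
    by_cases hi : (i : ℕ) < r <;> simp [hi]
  have e2 : V * Matrix.diagonal μ * Vᴴ - Z = V * (Matrix.diagonal μ - Vᴴ * Z * V) * Vᴴ := by
    rw [Matrix.mul_sub, Matrix.sub_mul]
    congr 1
    calc Z = (V * Vᴴ) * Z * (V * Vᴴ) := by rw [hV'', Matrix.one_mul, Matrix.mul_one]
      _ = _ := by simp only [Matrix.mul_assoc]
  rw [e1, e2, frobNorm_unitary_conj hV', frobNorm_unitary_conj hV']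
  refine frobNorm_diagonal_tail_le hr μ hμ _ ?_
  rw [Matrix.mul_assoc]
  exact (Matrix.rank_mul_le_right _ _).trans ((Matrix.rank_mul_le_left _ _).trans hZ)

end IsLeadingEigen

/-! ### The Cayley map on 𝔲(N) and its derivative -/

section Calculus

open scoped Matrix.Norms.Frobenius

/-- The inclusion of `𝔲(N)` into the matrices. -/
noncomputable def coeL (N : ℕ) : uLie N →L[ℝ] Matrix (Fin N) (Fin N) ℂ :=
  LinearMap.toContinuousLinearMap
    { toFun := fun A => A.1
      map_add' := fun _ _ => rfl
      map_smul' := fun _ _ => rfl }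

@[simp] theorem coeL_apply {N : ℕ} (A : uLie N) : coeL N A = A.1 := rfl

/-- A skew-Hermitian matrix as an element of `𝔲(N)`. -/
def ofSkew {N : ℕ} (A : Matrix (Fin N) (Fin N) ℂ) (hA : Aᴴ = -A) : uLie N :=
  ⟨A, skewAdjoint.mem_iff.2 hA⟩

@[simp] theorem coe_ofSkew {N : ℕ} (A : Matrix (Fin N) (Fin N) ℂ) (hA : Aᴴ = -A) :
    (ofSkew A hA : Matrix (Fin N) (Fin N) ℂ) = A := rfl

theorem half_sub_conjTranspose_skew {N : ℕ} (A : Matrix (Fin N) (Fin N) ℂ) :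
    ((1 / 2 : ℝ) • (A - Aᴴ))ᴴ = -((1 / 2 : ℝ) • (A - Aᴴ)) := by
  rw [Matrix.conjTranspose_smul, Matrix.conjTranspose_sub, Matrix.conjTranspose_conjTranspose,
    ← smul_neg, neg_sub, star_trivial]

/-- The skew-Hermitian part of a matrix. -/
noncomputable def skewL (N : ℕ) : Matrix (Fin N) (Fin N) ℂ →L[ℝ] uLie N :=
  LinearMap.toContinuousLinearMap
    { toFun := fun A => ofSkew ((1 / 2 : ℝ) • (A - Aᴴ)) (half_sub_conjTranspose_skew A)
      map_add' := fun A B => uLie.ext (by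
        simp only [uLie.coe_add, coe_ofSkew, Matrix.conjTranspose_add]
        module)
      map_smul' := fun c A => uLie.ext (by
        simp only [uLie.coe_smul, coe_ofSkew, Matrix.conjTranspose_smul, star_trivial,
          RingHom.id_apply]
        module) }

theorem coe_skewL {N : ℕ} {A : Matrix (Fin N) (Fin N) ℂ} (hA : Aᴴ = -A) :
    (skewL N A : Matrix (Fin N) (Fin N) ℂ) = A := by
  change (1 / 2 : ℝ) • (A - Aᴴ) = A
  rw [hA]
  module

/-- The stream matrix as a continuous linear map on `𝔲(N)`. -/
noncomputable def streamL (N : ℕ) : uLie N →L[ℝ] Matrix (Fin N) (Fin N) ℂ :=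
  (LinearMap.toContinuousLinearMap (streamLin N)).comp (coeL N)

@[simp] theorem streamL_apply {N : ℕ} (A : uLie N) : streamL N A = streamMatrix A.1 := rfl

/-- The map `X ↦ (1 + h P(X)) X (1 - h P(X))` on `𝔲(N)`. -/
noncomputable def cayleyMap {N : ℕ} (h : ℝ) (X : uLie N) : uLie N :=
  skewL N ((1 + h • streamL N X) * coeL N X * (1 - h • streamL N X))

theorem smul_streamMatrix_skew {N : ℕ} (h : ℝ) (X : uLie N) :
    (h • streamMatrix X.1)ᴴ = -(h • streamMatrix X.1) := by
  rw [Matrix.conjTranspose_smul, streamMatrix_skew X.conjTranspose_coe, star_trivial, smul_neg]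

theorem coe_cayleyMap {N : ℕ} (h : ℝ) (X : uLie N) :
    (cayleyMap h X : Matrix (Fin N) (Fin N) ℂ) =
      (1 + h • streamMatrix X.1) * X.1 * (1 - h • streamMatrix X.1) := by
  refine coe_skewL ?_
  have hL := smul_streamMatrix_skew h X
  simp only [streamL_apply, coeL_apply]
  rw [Matrix.conjTranspose_mul, Matrix.conjTranspose_mul, conjTranspose_one_add_skew hL,
    conjTranspose_one_sub_skew hL, X.conjTranspose_coe, Matrix.neg_mul, Matrix.mul_neg,
    Matrix.mul_assoc]

theorem contDiff_cayleyMap {N : ℕ} (h : ℝ) : ContDiff ℝ ∞ (cayleyMap (N := N) h) := by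
  refine (skewL N).contDiff.comp ?_
  have hP : ContDiff ℝ ∞ fun X : uLie N => h • streamL N X := (streamL N).contDiff.const_smul h
  exact ((contDiff_const.add hP).mul (coeL N).contDiff).mul (contDiff_const.sub hP)

theorem isIsoStep_iff_cayleyMap {N : ℕ} (Δt : ℝ) (Y : uLie N) (X Y' : Matrix (Fin N) (Fin N) ℂ) :
    IsIsoStep Δt Y X Y' ↔ ∃ X₀ : uLie N, X = X₀ ∧ cayleyMap (Δt / (2 * hbar N)) X₀ = Y ∧
      Y' = cayleyMap (-(Δt / (2 * hbar N))) X₀ := by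
  rw [isIsoStep_iff]
  have key : ∀ X₀ : uLie N, (cayleyMap (-(Δt / (2 * hbar N))) X₀ : Matrix (Fin N) (Fin N) ℂ) =
      (1 - stepGen Δt X₀.1) * X₀.1 * (1 + stepGen Δt X₀.1) := fun X₀ => by
    rw [coe_cayleyMap, neg_smul, ← sub_eq_add_neg, sub_neg_eq_add, stepGen]
  constructor
  · rintro ⟨hX, h1, h2⟩
    refine ⟨ofSkew X hX, rfl, uLie.ext ?_, ?_⟩
    · rw [coe_cayleyMap, h1, stepGen, coe_ofSkew]
    · rw [key, h2, coe_ofSkew]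
  · rintro ⟨X₀, rfl, h1, h2⟩
    refine ⟨X₀.conjTranspose_coe, ?_, ?_⟩
    · rw [← h1, coe_cayleyMap, stepGen]
    · rw [h2, key]

theorem hasFDerivAt_cayleyMap {N : ℕ} (h : ℝ) (X : uLie N) :
    ∃ A : uLie N →L[ℝ] uLie N, HasFDerivAt (cayleyMap h) A X ∧ ∀ V : uLie N,
      (A V : Matrix (Fin N) (Fin N) ℂ) =
        (1 + h • streamMatrix X.1) * V.1 * (1 - h • streamMatrix X.1) +
        h • (streamMatrix V.1 * X.1 * (1 - h • streamMatrix X.1)) -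
        h • ((1 + h • streamMatrix X.1) * X.1 * streamMatrix V.1) := by
  have hP : HasFDerivAt (fun X : uLie N => h • streamL N X) (h • streamL N) X :=
    (streamL N).hasFDerivAt.const_smul h
  have h1 := ((hP.const_add 1).mul' (coeL N).hasFDerivAt).mul' (hP.const_sub 1)
  refine ⟨_, (skewL N).hasFDerivAt.comp X h1, fun V => ?_⟩
  have hL := smul_streamMatrix_skew h X
  have hV := streamMatrix_skew V.conjTranspose_coe
  -- The product rule gives the skew part of a matrix; that matrix is already skew-Hermitian, so
  -- `skewL` can be dropped.
  refine (congrArg (fun Z => ((skewL N Z : uLie N) : Matrix (Fin N) (Fin N) ℂ)) (a₂ :=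
    (1 + h • streamMatrix X.1) * V.1 * (1 - h • streamMatrix X.1) +
        h • (streamMatrix V.1 * X.1 * (1 - h • streamMatrix X.1)) -
        h • ((1 + h • streamMatrix X.1) * X.1 * streamMatrix V.1)) ?_).trans (coe_skewL ?_)
  · change (1 + h • streamMatrix X.1) * X.1 * -(h • streamMatrix V.1) +
      ((1 + h • streamMatrix X.1) * V.1 + h • streamMatrix V.1 * X.1) *
        (1 - h • streamMatrix X.1) = _
    simp only [Matrix.mul_neg, Matrix.mul_smul, Matrix.smul_mul, Matrix.add_mul (_ * _)]
    abel
  · rw [Matrix.conjTranspose_sub, Matrix.conjTranspose_add, Matrix.conjTranspose_smul,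
      Matrix.conjTranspose_smul]
    simp only [Matrix.conjTranspose_mul, conjTranspose_one_add_skew hL,
      conjTranspose_one_sub_skew hL, X.conjTranspose_coe, V.conjTranspose_coe, hV, star_trivial]
    simp only [Matrix.neg_mul, Matrix.mul_neg, neg_neg, Matrix.mul_assoc]
    abel

end Calculus

/-! ### The Lie-Poisson property -/

/-- The trace identity behind the Poisson property: `M = 1 + h P(X)`, `M' = 1 - h P(X)`, and
`(ξ, ξ')`, `(η, η')` are pairs of covectors with the same pullback to the stage `X`. -/
theorem trace_commutator_eq_of_pullback_eq {N : ℕ} (h : ℝ)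
    {X ξ ξ' η η' M M' : Matrix (Fin N) (Fin N) ℂ}
    (hM : M = 1 + h • streamMatrix X) (hM' : M' = 1 - h • streamMatrix X)
    (hξ : M' * ξ * M + h • streamMatrix (X * M' * ξ - ξ * M * X) =
      M * ξ' * M' - h • streamMatrix (X * M * ξ' - ξ' * M' * X))
    (hη : M' * η * M + h • streamMatrix (X * M' * η - η * M * X) =
      M * η' * M' - h • streamMatrix (X * M * η' - η' * M' * X)) :
    (M * X * M' * (ξ * η - η * ξ)).trace = (M' * X * M * (ξ' * η' - η' * ξ')).trace := by
  -- The differences M'ξ - Mξ' and ξM - ξ'M' are expressed through the sums s, t and w = Xs - tX,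
  -- using the pullback identity to eliminate M ξ' M' - M' ξ M.
  have key : ∀ {ξ ξ' : Matrix (Fin N) (Fin N) ℂ},
      M' * ξ * M + h • streamMatrix (X * M' * ξ - ξ * M * X) =
        M * ξ' * M' - h • streamMatrix (X * M * ξ' - ξ' * M' * X) →
      M' * ξ - M * ξ' = -((M' * ξ + M * ξ') * (h • streamMatrix X) + h • streamMatrix
        (X * (M' * ξ + M * ξ') - (ξ * M + ξ' * M') * X)) ∧
      ξ * M - ξ' * M' = (h • streamMatrix X) * (ξ * M + ξ' * M') - h • streamMatrix
        (X * (M' * ξ + M * ξ') - (ξ * M + ξ' * M') * X) := by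
    intro ξ ξ' e
    have e1 : X * (M' * ξ + M * ξ') - (ξ * M + ξ' * M') * X =
        (X * M' * ξ - ξ * M * X) + (X * M * ξ' - ξ' * M' * X) := by noncomm_ring
    rw [e1, streamMatrix_add, smul_add]
    have e2 : h • streamMatrix (X * M' * ξ - ξ * M * X) +
        h • streamMatrix (X * M * ξ' - ξ' * M' * X) = M * ξ' * M' - M' * ξ * M := by
      rw [eq_sub_iff_add_eq] at e
      rw [← e]
      abel
    rw [e2]
    generalize h • streamMatrix X = L at hM hM'
    subst hM hM'
    constructor <;> noncomm_ring
  obtain ⟨hd, he⟩ := key hξ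
  obtain ⟨hd', he'⟩ := key hη
  set s := M' * ξ + M * ξ' with hs
  set t := ξ * M + ξ' * M' with ht
  set s' := M' * η + M * η' with hs'
  set t' := η * M + η' * M' with ht'
  set w := X * s - t * X with hw
  set w' := X * s' - t' * X with hw'
  -- Polarization 2(ab - a'b') = (a+a')(b-b') + (a-a')(b+b'). The terms s L t' cancel, leaving only
  -- stream matrices of w and w'.
  have h1 : (2 : ℂ) • ((M' * ξ) * (η * M) - (M * ξ') * (η' * M')) =
      -(s * (h • streamMatrix w') + (h • streamMatrix w) * t') := by
    calc (2 : ℂ) • ((M' * ξ) * (η * M) - (M * ξ') * (η' * M'))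
        = s * (η * M - η' * M') + (M' * ξ - M * ξ') * t' := by
          rw [hs, ht', two_smul]; noncomm_ring
      _ = _ := by rw [hd, he']; noncomm_ring
  have h2 : (2 : ℂ) • ((M' * η) * (ξ * M) - (M * η') * (ξ' * M')) =
      -(s' * (h • streamMatrix w) + (h • streamMatrix w') * t) := by
    calc (2 : ℂ) • ((M' * η) * (ξ * M) - (M * η') * (ξ' * M'))
        = s' * (ξ * M - ξ' * M') + (M' * η - M * η') * t := by
          rw [hs', ht, two_smul]; noncomm_ring
      _ = _ := by rw [hd', he]; noncomm_ring
  have cyc : ∀ A B ξ η : Matrix (Fin N) (Fin N) ℂ,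
      (A * X * B * (ξ * η - η * ξ)).trace =
        (X * ((B * ξ) * (η * A))).trace - (X * ((B * η) * (ξ * A))).trace := by
    intro A B ξ η
    rw [Matrix.mul_sub, Matrix.trace_sub]
    congr 1 <;>
    · rw [Matrix.mul_assoc A, Matrix.mul_assoc A, Matrix.trace_mul_comm]
      simp only [Matrix.mul_assoc]
  rw [cyc, cyc]
  have g1 := congrArg (fun Z => (X * Z).trace) h1
  have g2 := congrArg (fun Z => (X * Z).trace) h2
  simp only [Matrix.mul_smul, Matrix.trace_smul, smul_eq_mul, Matrix.mul_sub, Matrix.trace_sub,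
    Matrix.mul_neg, Matrix.trace_neg, Matrix.mul_add, Matrix.trace_add, Matrix.smul_mul] at g1 g2
  have c1 : (X * (streamMatrix w * t')).trace = (t' * X * streamMatrix w).trace := by
    rw [← Matrix.mul_assoc, Matrix.trace_mul_comm, Matrix.mul_assoc]
  have c2 : (X * (streamMatrix w' * t)).trace = (t * X * streamMatrix w').trace := by
    rw [← Matrix.mul_assoc, Matrix.trace_mul_comm, Matrix.mul_assoc]
  -- After pairing with X, the difference of `h1` and `h2` is a multiple of tr(w P(w')) - tr(w'
  -- P(w)), which vanishes here.
  have hsym : (w * streamMatrix w').trace = (w' * streamMatrix w).trace := by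
    rw [trace_mul_streamMatrix, Matrix.trace_mul_comm]
  have hx1 : (w * streamMatrix w').trace =
      (X * (s * streamMatrix w')).trace - (t * X * streamMatrix w').trace := by
    nth_rw 1 [hw]
    rw [Matrix.sub_mul, Matrix.trace_sub, Matrix.mul_assoc]
  have hx2 : (w' * streamMatrix w).trace =
      (X * (s' * streamMatrix w)).trace - (t' * X * streamMatrix w).trace := by
    nth_rw 1 [hw']
    rw [Matrix.sub_mul, Matrix.trace_sub, Matrix.mul_assoc]
  rw [c1] at g1
  rw [c2] at g2
  rw [hx1, hx2] at hsym
  simp only [Complex.real_smul] at g1 g2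
  linear_combination (1 / 2 : ℂ) * g1 - (1 / 2 : ℂ) * g2 - (h / 2 : ℂ) * hsym

theorem inner_eq_neg_trace {N : ℕ} (A B : uLie N) : inner ℝ A B = -(A.1 * B.1).trace.re := by
  rw [uLie.inner_def, A.conjTranspose_coe, Matrix.neg_mul, Matrix.trace_neg, Complex.neg_re]

/-- Testing with V = Z suffices, since Z itself lies in 𝔲(N). This turns equality of pullbacks
against all V into a matrix identity. -/
theorem eq_zero_of_trace_mul {N : ℕ} {Z : Matrix (Fin N) (Fin N) ℂ} (hZ : Zᴴ = -Z)
    (h : ∀ V : uLie N, (Z * V.1).trace.re = 0) : Z = 0 := by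
  have h1 : inner ℝ (ofSkew Z hZ) (ofSkew Z hZ) = 0 := by
    exact (inner_eq_neg_trace _ _).trans ((congrArg Neg.neg (h (ofSkew Z hZ))).trans neg_zero)
  exact congrArg (fun A : uLie N => A.1) (inner_self_eq_zero.1 h1)

/-- The transpose of the derivative of `cayleyMap`. -/
theorem trace_mul_cayleyMap_deriv {N : ℕ} (h : ℝ) (X ξ V M M' : Matrix (Fin N) (Fin N) ℂ) :
    (ξ * (M * V * M' + h • (streamMatrix V * X * M') - h • (M * X * streamMatrix V))).trace =
      ((M' * ξ * M + h • streamMatrix (X * M' * ξ - ξ * M * X)) * V).trace := by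
  have e1 : (ξ * (M * V * M')).trace = (M' * ξ * M * V).trace := by
    rw [Matrix.trace_mul_comm, Matrix.mul_assoc, Matrix.trace_mul_comm]
    simp only [Matrix.mul_assoc]
  have e2 : (ξ * (streamMatrix V * X * M')).trace = (X * M' * ξ * streamMatrix V).trace := by
    rw [Matrix.trace_mul_comm, Matrix.mul_assoc, Matrix.mul_assoc, Matrix.trace_mul_comm]
    simp only [Matrix.mul_assoc]
  have e3 : (ξ * (M * X * streamMatrix V)).trace = (ξ * M * X * streamMatrix V).trace := by
    simp only [Matrix.mul_assoc]
  rw [Matrix.add_mul, Matrix.smul_mul, Matrix.trace_add, Matrix.trace_smul,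
    ← trace_mul_streamMatrix, Matrix.sub_mul, Matrix.trace_sub, Matrix.mul_sub, Matrix.mul_add,
    Matrix.mul_smul, Matrix.mul_smul, Matrix.trace_sub, Matrix.trace_add, Matrix.trace_smul,
    Matrix.trace_smul, e1, e2, e3, smul_sub]
  ring

/-- If `A`, `B` are the derivatives at the stage `X` of the maps to the initial and to the final
value of a step, then covectors with the same pullback have the same commutator pairing. -/
theorem trace_commutator_cayleyMap {N : ℕ} (h : ℝ) (X : uLie N) {A B : uLie N →L[ℝ] uLie N}
    (hA : ∀ V : uLie N, (A V : Matrix (Fin N) (Fin N) ℂ) =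
        (1 + h • streamMatrix X.1) * V.1 * (1 - h • streamMatrix X.1) +
        h • (streamMatrix V.1 * X.1 * (1 - h • streamMatrix X.1)) -
        h • ((1 + h • streamMatrix X.1) * X.1 * streamMatrix V.1))
    (hB : ∀ V : uLie N, (B V : Matrix (Fin N) (Fin N) ℂ) =
        (1 + (-h) • streamMatrix X.1) * V.1 * (1 - (-h) • streamMatrix X.1) +
        (-h) • (streamMatrix V.1 * X.1 * (1 - (-h) • streamMatrix X.1)) -
        (-h) • ((1 + (-h) • streamMatrix X.1) * X.1 * streamMatrix V.1))
    {ξ ξ' η η' : uLie N} (hξ : ∀ V, inner ℝ ξ (A V) = inner ℝ ξ' (B V))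
    (hη : ∀ V, inner ℝ η (A V) = inner ℝ η' (B V)) :
    ((cayleyMap h X).1 * (ξ.1 * η.1 - η.1 * ξ.1)).trace =
      ((cayleyMap (-h) X).1 * (ξ'.1 * η'.1 - η'.1 * ξ'.1)).trace := by
  have hL := smul_streamMatrix_skew h X
  have key : ∀ {ξ ξ' : uLie N}, (∀ V, inner ℝ ξ (A V) = inner ℝ ξ' (B V)) →
      (1 - h • streamMatrix X.1) * ξ.1 * (1 + h • streamMatrix X.1) + h • streamMatrix
        (X.1 * (1 - h • streamMatrix X.1) * ξ.1 - ξ.1 * (1 + h • streamMatrix X.1) * X.1) =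
      (1 + h • streamMatrix X.1) * ξ'.1 * (1 - h • streamMatrix X.1) - h • streamMatrix
        (X.1 * (1 + h • streamMatrix X.1) * ξ'.1 - ξ'.1 * (1 - h • streamMatrix X.1) * X.1) := by
    intro ξ ξ' e
    rw [← sub_eq_zero]
    refine eq_zero_of_trace_mul ?_ fun V => ?_
    · have w1 : (X.1 * (1 - h • streamMatrix X.1) * ξ.1 -
          ξ.1 * (1 + h • streamMatrix X.1) * X.1)ᴴ =
          -(X.1 * (1 - h • streamMatrix X.1) * ξ.1 -
          ξ.1 * (1 + h • streamMatrix X.1) * X.1) := by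
        simp only [Matrix.conjTranspose_sub, Matrix.conjTranspose_mul,
          conjTranspose_one_add_skew hL, conjTranspose_one_sub_skew hL, X.conjTranspose_coe,
          ξ.conjTranspose_coe, Matrix.neg_mul, Matrix.mul_neg, neg_neg, Matrix.mul_assoc]
        abel
      have w2 : (X.1 * (1 + h • streamMatrix X.1) * ξ'.1 -
          ξ'.1 * (1 - h • streamMatrix X.1) * X.1)ᴴ =
          -(X.1 * (1 + h • streamMatrix X.1) * ξ'.1 -
          ξ'.1 * (1 - h • streamMatrix X.1) * X.1) := by
        simp only [Matrix.conjTranspose_sub, Matrix.conjTranspose_mul,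
          conjTranspose_one_add_skew hL, conjTranspose_one_sub_skew hL, X.conjTranspose_coe,
          ξ'.conjTranspose_coe, Matrix.neg_mul, Matrix.mul_neg, neg_neg, Matrix.mul_assoc]
        abel
      rw [Matrix.conjTranspose_sub, Matrix.conjTranspose_add, Matrix.conjTranspose_sub,
        Matrix.conjTranspose_smul h, Matrix.conjTranspose_smul h, streamMatrix_skew w1,
        streamMatrix_skew w2]
      simp only [Matrix.conjTranspose_mul, conjTranspose_one_add_skew hL,
        conjTranspose_one_sub_skew hL, ξ.conjTranspose_coe, ξ'.conjTranspose_coe, star_trivial,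
        Matrix.neg_mul, Matrix.mul_neg, smul_neg, Matrix.mul_assoc]
      abel
    · have e' := e V
      rw [inner_eq_neg_trace, inner_eq_neg_trace, hA, hB, trace_mul_cayleyMap_deriv,
        trace_mul_cayleyMap_deriv, neg_inj] at e'
      rw [Matrix.sub_mul, Matrix.trace_sub, Complex.sub_re, e', sub_eq_zero]
      simp only [neg_smul, ← sub_eq_add_neg, sub_neg_eq_add]
  have h1 := key hξ
  have h2 := key hη
  rw [coe_cayleyMap, coe_cayleyMap, neg_smul, ← sub_eq_add_neg, sub_neg_eq_add]
  exact trace_commutator_eq_of_pullback_eq h rfl rfl h1 h2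

/-- A smooth branch of the isospectral integrator is a Lie-Poisson map. -/
theorem isLiePoissonMapOn_of_isIsoStep {N : ℕ} {Δt : ℝ} {D : Set (uLie N)} {σ Φ : uLie N → uLie N}
    (hD : IsOpen D) (hσ : ContDiffOn ℝ ∞ σ D)
    (h : ∀ Y ∈ D, IsIsoStep (N := N) Δt Y (σ Y) (Φ Y)) : IsLiePoissonMapOn D Φ := by
  set ε := Δt / (2 * hbar N) with hε
  have hstep : ∀ Y ∈ D, cayleyMap ε (σ Y) = Y ∧ Φ Y = cayleyMap (-ε) (σ Y) := by
    intro Y hY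
    obtain ⟨X₀, h1, h2, h3⟩ := (isIsoStep_iff_cayleyMap Δt Y _ _).1 (h Y hY)
    obtain rfl : σ Y = X₀ := uLie.ext h1
    exact ⟨h2, uLie.ext h3⟩
  have hΦ : ContDiffOn ℝ ∞ Φ D :=
    ((contDiff_cayleyMap (-ε)).comp_contDiffOn hσ).congr fun Y hY => (hstep Y hY).2
  refine ⟨hΦ, fun F G hF hG Y hY => ?_⟩
  have hnhds : D ∈ nhds Y := hD.mem_nhds hY
  have hΦd : HasFDerivAt Φ (fderiv ℝ Φ Y) Y :=
    ((hΦ.contDiffAt hnhds).differentiableAt (by simp)).hasFDerivAt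
  have hσd : HasFDerivAt σ (fderiv ℝ σ Y) Y :=
    ((hσ.contDiffAt hnhds).differentiableAt (by simp)).hasFDerivAt
  obtain ⟨A, hA, hA'⟩ := hasFDerivAt_cayleyMap ε (σ Y)
  obtain ⟨B, hB, hB'⟩ := hasFDerivAt_cayleyMap (-ε) (σ Y)
  have e1 : A.comp (fderiv ℝ σ Y) = ContinuousLinearMap.id ℝ (uLie N) := by
    refine (hA.comp Y hσd).unique ((hasFDerivAt_id Y).congr_of_eventuallyEq ?_)
    filter_upwards [hnhds] with Z hZ using (hstep Z hZ).1
  have e2 : fderiv ℝ Φ Y = B.comp (fderiv ℝ σ Y) := by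
    refine hΦd.unique ((hB.comp Y hσd).congr_of_eventuallyEq ?_)
    filter_upwards [hnhds] with Z hZ using (hstep Z hZ).2
  -- In finite dimension the right inverse of A is also a left inverse, so covectors at Y can be
  -- tested on vectors A V coming from the stage.
  have e3 : ∀ V, fderiv ℝ σ Y (A V) = V := by
    have e : (A : uLie N →ₗ[ℝ] uLie N) ∘ₗ (fderiv ℝ σ Y : uLie N →ₗ[ℝ] uLie N) = LinearMap.id :=
      LinearMap.ext fun V => DFunLike.congr_fun e1 V
    exact fun V => LinearMap.congr_fun (mul_eq_one_comm.1 e) V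
  have pull : ∀ F : uLie N → ℝ, ContDiff ℝ ∞ F → ∀ V,
      inner ℝ (gradient (F ∘ Φ) Y) (A V) = inner ℝ (gradient F (Φ Y)) (B V) := by
    intro F hF V
    have hFd : HasFDerivAt F (fderiv ℝ F (Φ Y)) (Φ Y) :=
      (hF.differentiable (by simp) _).hasFDerivAt
    rw [gradient, gradient, InnerProductSpace.toDual_symm_apply,
      InnerProductSpace.toDual_symm_apply, (hFd.comp Y hΦd).fderiv, e2]
    simp only [ContinuousLinearMap.comp_apply, e3]
  have key := trace_commutator_cayleyMap ε (σ Y) hA' hB' (pull F hF) (pull G hG)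
  rw [(hstep Y hY).1, ← (hstep Y hY).2] at key
  rw [lpBracket, lpBracket, Y.conjTranspose_coe, (Φ Y).conjTranspose_coe, commN, commN,
    Matrix.mul_smul, Matrix.mul_smul, Matrix.neg_mul, Matrix.neg_mul, Matrix.trace_smul,
    Matrix.trace_smul, Matrix.trace_neg, Matrix.trace_neg, key]

/-! ### Smooth inversion, midpoint quadrature and the local error -/

section Analysis

variable {E : Type*} [NormedAddCommGroup E] [NormedSpace ℝ E]

theorem exists_lipschitz_closedBall [FiniteDimensional ℝ E] {f : E → E} (hf : ContDiff ℝ ∞ f)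
    (R : ℝ) : ∃ K : ℝ, 0 ≤ K ∧ ∀ x ∈ Metric.closedBall (0 : E) R,
      ∀ y ∈ Metric.closedBall (0 : E) R, ‖f x - f y‖ ≤ K * ‖x - y‖ := by
  have : ProperSpace E := FiniteDimensional.proper ℝ E
  have h1 : LocallyLipschitz f := (hf.of_le (by simp)).locallyLipschitz
  obtain ⟨K, hK⟩ := (h1.locallyLipschitzOn).exists_lipschitzOnWith_of_compact
    (isCompact_closedBall (0 : E) R)
  exact ⟨K, K.2, fun x hx y hy => hK.norm_sub_le hx hy⟩

theorem exists_bound_closedBall [FiniteDimensional ℝ E] {f : E → E} (hf : ContDiff ℝ ∞ f)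
    (R : ℝ) : ∃ K : ℝ, 0 ≤ K ∧ ∀ x ∈ Metric.closedBall (0 : E) R, ‖f x‖ ≤ K := by
  have : ProperSpace E := FiniteDimensional.proper ℝ E
  obtain ⟨C, hC⟩ := (isCompact_closedBall (0 : E) R).exists_bound_of_continuousOn
    hf.continuous.continuousOn
  exact ⟨max C 0, le_max_right _ _, fun x hx => (hC x hx).trans (le_max_left _ _)⟩

/-- A smooth map that is close to the identity on a ball and does not decrease norms has a smooth
inverse on the ball of half the radius. -/
theorem exists_smooth_inverse [FiniteDimensional ℝ E] {f : E → E} (hf : ContDiff ℝ ∞ f)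
    (h0 : f 0 = 0) {R : ℝ} (hR : 0 < R)
    (hlip : ∀ x ∈ Metric.closedBall (0 : E) (2 * R), ∀ y ∈ Metric.closedBall (0 : E) (2 * R),
      ‖f x - f y - (x - y)‖ ≤ 1 / 2 * ‖x - y‖)
    (hap : ∀ x, ‖x‖ ≤ ‖f x‖) :
    ∃ σ : E → E, ContDiffOn ℝ ∞ σ (Metric.ball 0 R) ∧
      ∀ y ∈ Metric.ball (0 : E) R, ∀ x, f x = y ↔ x = σ y := by
  have : CompleteSpace E := FiniteDimensional.complete ℝ E
  have hA : ApproximatesLinearOn f (ContinuousLinearEquiv.refl ℝ E : E →L[ℝ] E)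
      (Metric.closedBall 0 (2 * R)) (1 / 2) := fun x hx y hy => by
    simpa using hlip x hx y hy
  have hA' := hA.mono_set (Metric.ball_subset_closedBall (x := (0 : E)) (ε := 2 * R))
  have hc : Subsingleton E ∨
      (1 / 2 : NNReal) < ‖((ContinuousLinearEquiv.refl ℝ E).symm : E →L[ℝ] E)‖₊⁻¹ := by
    rcases subsingleton_or_nontrivial E with h | h
    · exact Or.inl h
    · right
      have : ‖((ContinuousLinearEquiv.refl ℝ E).symm : E →L[ℝ] E)‖₊ = 1 :=
        NNReal.eq (by simp)
      rw [this, inv_one]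
      exact NNReal.half_lt_self one_ne_zero
  let e := hA'.toOpenPartialHomeomorph f _ hc Metric.isOpen_ball
  have hsurj : ∀ y ∈ Metric.ball (0 : E) R, ∃ x ∈ Metric.ball (0 : E) (2 * R), f x = y := by
    intro y hy
    let fs : ContinuousLinearMap.NonlinearRightInverse
        (ContinuousLinearEquiv.refl ℝ E : E →L[ℝ] E) :=
      { toFun := id
        nnnorm := 1
        bound' := fun y => by simp
        right_inv' := fun y => rfl }
    -- The image of the closed ball of radius 2R covers the closed ball of radius (1 - 1/2)·2R = R.
    have h := hA.surjOn_closedBall_of_nonlinearRightInverse fs (ε := 2 * R) (b := 0) (by linarith)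
      le_rfl
    rw [h0] at h
    have hy' : ‖y‖ < R := by simpa using hy
    obtain ⟨x, -, hx⟩ := h (show y ∈ _ by
      rw [mem_closedBall_zero_iff]
      refine hy'.le.trans (le_of_eq ?_)
      simp only [fs]
      push_cast
      ring)
    refine ⟨x, ?_, hx⟩
    have := hap x
    rw [hx] at this
    rw [mem_ball_zero_iff]
    linarith
  have htar : Metric.ball (0 : E) R ⊆ e.target := fun y hy => hsurj y hy
  have hsymm : ∀ y ∈ Metric.ball (0 : E) R, e.symm y ∈ Metric.ball (0 : E) (2 * R) ∧
      f (e.symm y) = y := fun y hy => ⟨e.map_target (htar hy), e.right_inv (htar hy)⟩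
  refine ⟨e.symm, fun y hy => ?_, fun y hy x => ⟨fun hx => ?_, ?_⟩⟩
  · obtain ⟨h1, h2⟩ := hsymm y hy
    set x := e.symm y with hx
    have hd : HasFDerivAt f (fderiv ℝ f x) x := (hf.differentiable (by simp) x).hasFDerivAt
    -- The Lipschitz bound for f - id passes to the derivative, which is then injective, hence
    -- invertible; this makes the local inverse smooth.
    have hn : ‖fderiv ℝ f x - ContinuousLinearMap.id ℝ E‖ ≤ 1 / 2 := by
      refine (hd.sub (hasFDerivAt_id x)).le_of_lip' (by norm_num) ?_
      filter_upwards [Metric.isOpen_ball.mem_nhds h1] with z hz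
      have := hlip z (Metric.ball_subset_closedBall hz) x (Metric.ball_subset_closedBall h1)
      convert this using 2
      simp only [Pi.sub_apply, id_eq]
      abel
    have hinj : Function.Injective (fderiv ℝ f x : E →ₗ[ℝ] E) := by
      rw [injective_iff_map_eq_zero]
      intro v hv
      have h3 := (fderiv ℝ f x - ContinuousLinearMap.id ℝ E).le_of_opNorm_le hn v
      have hv' : fderiv ℝ f x v = 0 := hv
      rw [sub_apply, hv', ContinuousLinearMap.id_apply, zero_sub,
        norm_neg] at h3
      have := norm_nonneg v
      exact norm_eq_zero.1 (by linarith)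
    let A := (LinearEquiv.ofInjectiveEndo _ hinj).toContinuousLinearEquiv
    have hA0 : (A : E →L[ℝ] E) = fderiv ℝ f x := by
      ext v
      rfl
    rw [← hA0] at hd
    exact (e.contDiffAt_symm (htar hy) hd hf.contDiffAt).contDiffWithinAt
  · obtain ⟨h1, h2⟩ := hsymm y hy
    -- Uniqueness is among all x in E: the bound ‖x‖ ≤ ‖f x‖ forces every preimage into the ball
    -- where f is injective.
    refine hA'.injOn hc ?_ h1 (hx.trans h2.symm)
    have := hap x
    rw [hx] at this
    rw [mem_ball_zero_iff] at hy ⊢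
    linarith
  · rintro rfl
    exact (hsymm y hy).2

/-- The error of the midpoint quadrature rule. -/
theorem norm_midpoint_quadrature_le {u v w : ℝ → E} {T L : ℝ} (hT : 0 ≤ T) (hL : 0 ≤ L)
    (hu : ∀ t ∈ Set.Icc 0 T, HasDerivWithinAt u (v t) (Set.Icc 0 T) t)
    (hv : ∀ t ∈ Set.Icc 0 T, HasDerivWithinAt v (w t) (Set.Icc 0 T) t)
    (hw : ∀ t ∈ Set.Icc 0 T, ∀ s ∈ Set.Icc 0 T, ‖w t - w s‖ ≤ L * |t - s|) :
    ‖u T - u 0 - T • v (T / 2)‖ ≤ L * T ^ 3 := by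
  have hm : T / 2 ∈ Set.Icc 0 T := ⟨by linarith, by linarith⟩
  have h0 : (0 : ℝ) ∈ Set.Icc 0 T := ⟨le_rfl, hT⟩
  have h1 : T ∈ Set.Icc 0 T := ⟨hT, le_rfl⟩
  have hdist : ∀ t ∈ Set.Icc 0 T, |t - T / 2| ≤ T := fun t ht => by
    rw [abs_le]
    constructor <;> linarith [ht.1, ht.2]
  have hρ : ∀ t ∈ Set.Icc 0 T, ‖v t - v (T / 2) - (t - T / 2) • w (T / 2)‖ ≤ L * T ^ 2 := by
    intro t ht
    have hd : ∀ s ∈ Set.Icc 0 T, HasDerivWithinAt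
        (fun s => v s - v (T / 2) - (s - T / 2) • w (T / 2)) (w s - w (T / 2)) (Set.Icc 0 T) s := by
      intro s hs
      have := ((hv s hs).sub_const (v (T / 2))).sub
        (((hasDerivWithinAt_id s _).sub_const (T / 2)).smul_const (w (T / 2)))
      exact this.congr_deriv (by simp)
    have := (convex_Icc 0 T).norm_image_sub_le_of_norm_hasDerivWithin_le hd
      (C := L * T) (fun s hs => (hw s hs _ hm).trans
        (mul_le_mul_of_nonneg_left (hdist s hs) hL)) hm ht
    simp only [sub_self, zero_smul, sub_zero, Real.norm_eq_abs] at this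
    refine this.trans ?_
    calc L * T * |t - T / 2| ≤ L * T * T :=
          mul_le_mul_of_nonneg_left (hdist t ht) (mul_nonneg hL hT)
      _ = _ := by ring
  -- The quadratic Taylor term about the midpoint takes the same value at 0 and T, so it drops out
  -- of the increment and the error is cubic.
  have hd : ∀ s ∈ Set.Icc 0 T, HasDerivWithinAt
      (fun s => u s - s • v (T / 2) - ((1 / 2 : ℝ) * (s - T / 2) ^ 2) • w (T / 2))
      (v s - v (T / 2) - (s - T / 2) • w (T / 2)) (Set.Icc 0 T) s := by
    intro s hs
    have hq : HasDerivWithinAt (fun s : ℝ => (1 / 2 : ℝ) * (s - T / 2) ^ 2) (s - T / 2)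
        (Set.Icc 0 T) s := by
      have := ((((hasDerivAt_id s).sub_const (T / 2)).pow 2).const_mul (1 / 2 : ℝ))
      refine (this.congr_deriv ?_).hasDerivWithinAt
      simp
    have := ((hu s hs).sub ((hasDerivWithinAt_id s _).smul_const (v (T / 2)))).sub
      (hq.smul_const (w (T / 2)))
    exact this.congr_deriv (by simp)
  have := (convex_Icc 0 T).norm_image_sub_le_of_norm_hasDerivWithin_le hd hρ h0 h1
  rw [sub_zero, Real.norm_eq_abs, abs_of_nonneg hT] at this
  refine le_trans (le_of_eq ?_) (this.trans (le_of_eq (by ring)))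
  congr 1
  module

/-- The local error of the isospectral integrator, for the equation `W' = F(W)`. -/
theorem exists_local_error_bound [FiniteDimensional ℝ E] {F G : E → E} (hF : ContDiff ℝ ∞ F)
    (hG : ContDiff ℝ ∞ G) (R : ℝ) :
    ∃ C : ℝ, ∀ (T : ℝ) (X : E) (W : ℝ → E), 0 < T → T ≤ 1 → ‖X‖ ≤ R →
      (∀ t ∈ Set.Icc 0 T, ‖W t‖ ≤ R) →
      (∀ t ∈ Set.Icc 0 T, HasDerivWithinAt W (F (W t)) (Set.Icc 0 T) t) →
      W 0 = X - (T / 2) • F X - ((T / 2) ^ 2) • G X →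
      ‖X + (T / 2) • F X - ((T / 2) ^ 2) • G X - W T‖ ≤ C * T ^ 3 := by
  have hH : ContDiff ℝ ∞ fun x => fderiv ℝ F x (F x) :=
    (hF.fderiv_right (m := ∞) (by simp)).clm_apply hF
  obtain ⟨MF, hMF0, hMF⟩ := exists_bound_closedBall hF R
  obtain ⟨MG, hMG0, hMG⟩ := exists_bound_closedBall hG R
  obtain ⟨LF, hLF0, hLF⟩ := exists_lipschitz_closedBall hF R
  obtain ⟨LH, hLH0, hLH⟩ := exists_lipschitz_closedBall hH R
  refine ⟨LF * ((LF * (MF + MG) + MG) + LF * MF) + LH * MF, ?_⟩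
  intro T X W hT hT1 hX hWR hW h0
  simp only [← mem_closedBall_zero_iff] at hX hWR
  have hm : T / 2 ∈ Set.Icc 0 T := ⟨by linarith, by linarith⟩
  have h0m : (0 : ℝ) ∈ Set.Icc 0 T := ⟨le_rfl, hT.le⟩
  have hWlip : ∀ t ∈ Set.Icc 0 T, ∀ s ∈ Set.Icc 0 T, ‖W t - W s‖ ≤ MF * |t - s| :=
    fun t ht s hs => (convex_Icc 0 T).norm_image_sub_le_of_norm_hasDerivWithin_le hW
      (fun s hs => hMF _ (hWR s hs)) hs ht
  have hquad : ‖W T - W 0 - T • F (W (T / 2))‖ ≤ LH * MF * T ^ 3 := by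
    refine norm_midpoint_quadrature_le (v := fun t => F (W t))
      (w := fun t => fderiv ℝ F (W t) (F (W t))) hT.le (mul_nonneg hLH0 hMF0) hW ?_ ?_
    · intro t ht
      exact (hF.differentiable (by simp) (W t)).hasFDerivAt.comp_hasDerivWithinAt t (hW t ht)
    · intro t ht s hs
      refine (hLH _ (hWR t ht) _ (hWR s hs)).trans ?_
      rw [mul_assoc]
      exact mul_le_mul_of_nonneg_left (hWlip t ht s hs) hLH0
  set τ := T / 2 with hτ
  have hτ0 : 0 ≤ τ := hm.1
  have hτ1 : τ ≤ 1 := by linarith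
  have hTτ : T = 2 * τ := by rw [hτ]; ring
  have hY := hWR 0 h0m
  have hFX := hMF X hX
  have hGX := hMG X hX
  have hXY : ‖X - W 0‖ ≤ τ * (MF + MG) := by
    rw [h0]
    calc ‖X - (X - τ • F X - τ ^ 2 • G X)‖ = ‖τ • F X + τ ^ 2 • G X‖ := by congr 1; abel
      _ ≤ τ * ‖F X‖ + τ ^ 2 * ‖G X‖ := by
        refine (norm_add_le _ _).trans (le_of_eq ?_)
        rw [norm_smul, norm_smul, Real.norm_of_nonneg hτ0, Real.norm_of_nonneg (sq_nonneg τ)]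
      _ ≤ τ * MF + τ * MG := by
        gcongr
        nlinarith
      _ = _ := by ring
  -- Both X and W(τ) agree with the Euler half step W(0) + τ F(W(0)) up to O(τ²), so they are O(τ²)
  -- apart.
  have hXs : ‖X - W 0 - τ • F (W 0)‖ ≤ (LF * (MF + MG) + MG) * τ ^ 2 := by
    calc ‖X - W 0 - τ • F (W 0)‖ = ‖τ • (F X - F (W 0)) + τ ^ 2 • G X‖ := by
          congr 1
          have : X - W 0 = τ • F X + τ ^ 2 • G X := by rw [h0]; abel
          rw [this]
          module
      _ ≤ τ * ‖F X - F (W 0)‖ + τ ^ 2 * ‖G X‖ := by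
        refine (norm_add_le _ _).trans (le_of_eq ?_)
        rw [norm_smul, norm_smul, Real.norm_of_nonneg hτ0, Real.norm_of_nonneg (sq_nonneg τ)]
      _ ≤ τ * (LF * (τ * (MF + MG))) + τ ^ 2 * MG := by
        gcongr
        exact (hLF X hX _ hY).trans (by gcongr)
      _ = _ := by ring
  have hWs : ‖W τ - W 0 - τ • F (W 0)‖ ≤ LF * MF * τ ^ 2 := by
    have hsub : Set.Icc 0 τ ⊆ Set.Icc 0 T := Set.Icc_subset_Icc le_rfl hm.2
    have hd : ∀ s ∈ Set.Icc 0 τ, HasDerivWithinAt (fun s => W s - s • F (W 0))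
        (F (W s) - F (W 0)) (Set.Icc 0 τ) s := by
      intro s hs
      have := ((hW s (hsub hs)).mono hsub).sub ((hasDerivWithinAt_id s _).smul_const (F (W 0)))
      exact this.congr_deriv (by simp)
    have hb : ∀ s ∈ Set.Icc 0 τ, ‖F (W s) - F (W 0)‖ ≤ LF * (MF * τ) := by
      intro s hs
      refine (hLF _ (hWR s (hsub hs)) _ hY).trans ?_
      have h3 := hWlip s (hsub hs) 0 h0m
      rw [sub_zero, abs_of_nonneg hs.1] at h3
      gcongr
      exact h3.trans (by gcongr; exact hs.2)
    have := (convex_Icc 0 τ).norm_image_sub_le_of_norm_hasDerivWithin_le hd hb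
      (x := 0) (y := τ) ⟨le_rfl, hτ0⟩ ⟨hτ0, le_rfl⟩
    rw [sub_zero, Real.norm_of_nonneg hτ0] at this
    refine le_trans (le_of_eq ?_) (this.trans (le_of_eq (by ring)))
    congr 1
    module
  have hXW : ‖X - W τ‖ ≤ ((LF * (MF + MG) + MG) + LF * MF) * τ ^ 2 := by
    calc ‖X - W τ‖ = ‖(X - W 0 - τ • F (W 0)) - (W τ - W 0 - τ • F (W 0))‖ := by congr 1; abel
      _ ≤ _ := (norm_sub_le _ _).trans (add_le_add hXs hWs)
      _ = _ := by ring
  -- The G terms in the initial value and in the update are equal and cancel, leaving the increment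
  -- T F(X).
  have hfin : X + τ • F X - τ ^ 2 • G X - W T =
      T • (F X - F (W τ)) - (W T - W 0 - T • F (W τ)) := by
    rw [h0, hTτ]
    module
  rw [hfin]
  calc ‖T • (F X - F (W τ)) - (W T - W 0 - T • F (W τ))‖
      ≤ T * ‖F X - F (W τ)‖ + LH * MF * T ^ 3 := by
        refine (norm_sub_le _ _).trans (add_le_add (le_of_eq ?_) hquad)
        rw [norm_smul, Real.norm_of_nonneg hT.le]
    _ ≤ T * (LF * (((LF * (MF + MG) + MG) + LF * MF) * T ^ 2)) + LH * MF * T ^ 3 := by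
        gcongr
        refine (hLF X hX _ (hWR τ hm)).trans ?_
        gcongr
        refine hXW.trans ?_
        gcongr
        exact hm.2
    _ = _ := by ring

end Analysis

/-! ### Norm bounds and the integrator for small steps -/

theorem norm_eq_frobNorm {N : ℕ} (A : uLie N) : ‖A‖ = frobNorm A.1 := by
  rw [norm_eq_sqrt_real_inner, uLie.inner_def, frobNorm]

theorem trace_le_trace_one_add_skew_mul {N : ℕ} {L : Matrix (Fin N) (Fin N) ℂ} (hL : Lᴴ = -L)
    (A : Matrix (Fin N) (Fin N) ℂ) :
    (Aᴴ * A).trace.re ≤ (((1 + L) * A)ᴴ * ((1 + L) * A)).trace.re := by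
  have h : ((1 + L) * A)ᴴ * ((1 + L) * A) = Aᴴ * A + (L * A)ᴴ * (L * A) := by
    rw [Matrix.conjTranspose_mul, Matrix.conjTranspose_mul, conjTranspose_one_add_skew hL, hL]
    noncomm_ring
  rw [h, Matrix.trace_add, Complex.add_re]
  exact le_add_of_nonneg_right (trace_conjTranspose_mul_self_re_nonneg _)

theorem trace_mul_conjTranspose_comm {N : ℕ} (A : Matrix (Fin N) (Fin N) ℂ) :
    (Aᴴᴴ * Aᴴ).trace.re = (Aᴴ * A).trace.re := by
  rw [Matrix.conjTranspose_conjTranspose, Matrix.trace_mul_comm]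

/-- Multiplication by 1+L adds ‖LA‖² to ‖A‖²; the right factor 1-L is treated by taking adjoints.
Being valid for all X and h, this bound confines every stage to the ball of its initial value. -/
theorem norm_le_norm_cayleyMap {N : ℕ} (h : ℝ) (X : uLie N) : ‖X‖ ≤ ‖cayleyMap h X‖ := by
  rw [norm_eq_frobNorm, norm_eq_frobNorm, coe_cayleyMap]
  refine Real.sqrt_le_sqrt ?_
  have hL := smul_streamMatrix_skew h X
  have h1 := trace_le_trace_one_add_skew_mul hL X.1
  have h2 := trace_le_trace_one_add_skew_mul hL ((1 + h • streamMatrix X.1) * X.1)ᴴ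
  rw [trace_mul_conjTranspose_comm] at h2
  have e : (1 + h • streamMatrix X.1) * ((1 + h • streamMatrix X.1) * X.1)ᴴ =
      ((1 + h • streamMatrix X.1) * X.1 * (1 - h • streamMatrix X.1))ᴴ := by
    rw [Matrix.conjTranspose_mul _ (1 - h • streamMatrix X.1), conjTranspose_one_sub_skew hL]
  rw [e, trace_mul_conjTranspose_comm] at h2
  exact h1.trans h2

section Fields

open scoped Matrix.Norms.Frobenius

/-- The vector field of the Zeitlin model on `𝔲(N)`. -/
noncomputable def zeitlinField {N : ℕ} (X : uLie N) : uLie N :=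
  skewL N (-((hbar N)⁻¹ • (streamL N X * coeL N X - coeL N X * streamL N X)))

/-- The quadratic correction `ħ⁻² P(X) X P(X)` in the isospectral integrator. -/
noncomputable def zeitlinCorrection {N : ℕ} (X : uLie N) : uLie N :=
  skewL N (((hbar N)⁻¹ ^ 2) • (streamL N X * coeL N X * streamL N X))

theorem contDiff_zeitlinField {N : ℕ} : ContDiff ℝ ∞ (zeitlinField (N := N)) := by
  refine (skewL N).contDiff.comp ?_
  have hP : ContDiff ℝ ∞ fun X : uLie N => streamL N X := (streamL N).contDiff
  have hX : ContDiff ℝ ∞ fun X : uLie N => coeL N X := (coeL N).contDiff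
  exact (((hP.mul hX).sub (hX.mul hP)).const_smul _).neg

theorem contDiff_zeitlinCorrection {N : ℕ} : ContDiff ℝ ∞ (zeitlinCorrection (N := N)) := by
  refine (skewL N).contDiff.comp ?_
  have hP : ContDiff ℝ ∞ fun X : uLie N => streamL N X := (streamL N).contDiff
  have hX : ContDiff ℝ ∞ fun X : uLie N => coeL N X := (coeL N).contDiff
  exact ((hP.mul hX).mul hP).const_smul _

theorem coe_zeitlinField {N : ℕ} (X : uLie N) :
    (zeitlinField X : Matrix (Fin N) (Fin N) ℂ) = -commN (streamMatrix X.1) X.1 := by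
  refine coe_skewL ?_
  have hP := streamMatrix_skew X.conjTranspose_coe
  simp only [streamL_apply, coeL_apply, Matrix.conjTranspose_neg, Matrix.conjTranspose_smul,
    Matrix.conjTranspose_sub, Matrix.conjTranspose_mul, hP, X.conjTranspose_coe, star_trivial]
  simp only [Matrix.neg_mul, Matrix.mul_neg, neg_neg]
  rw [← smul_neg, neg_sub]

theorem coe_zeitlinCorrection {N : ℕ} (X : uLie N) :
    (zeitlinCorrection X : Matrix (Fin N) (Fin N) ℂ) =
      ((hbar N)⁻¹ ^ 2) • (streamMatrix X.1 * X.1 * streamMatrix X.1) := by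
  refine coe_skewL ?_
  have hP := streamMatrix_skew X.conjTranspose_coe
  simp only [streamL_apply, coeL_apply, Matrix.conjTranspose_smul,
    Matrix.conjTranspose_mul, hP, X.conjTranspose_coe, star_trivial]
  simp only [Matrix.neg_mul, Matrix.mul_neg, neg_neg, smul_neg, Matrix.mul_assoc]

end Fields

/-- Puts initial value and result, at τ and -τ, in the form required by `exists_local_error_bound`.
-/
theorem cayleyMap_eq {N : ℕ} (τ : ℝ) (X : uLie N) :
    cayleyMap (τ / hbar N) X = X - τ • zeitlinField X - τ ^ 2 • zeitlinCorrection X := by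
  apply uLie.ext
  rw [coe_cayleyMap, uLie.coe_sub, uLie.coe_sub, uLie.coe_smul, uLie.coe_smul, coe_zeitlinField,
    coe_zeitlinCorrection, commN, div_eq_mul_inv, mul_smul, smul_smul (τ ^ 2), ← mul_pow, pow_two,
    mul_smul]
  have e : ∀ L : Matrix (Fin N) (Fin N) ℂ, (1 + L) * X.1 * (1 - L) =
      X.1 + (L * X.1 - X.1 * L) - L * X.1 * L := fun L => by noncomm_ring
  rw [e]
  simp only [Matrix.smul_mul, Matrix.mul_smul, smul_sub, smul_neg, smul_smul]
  module

theorem inner_zeitlinField {N : ℕ} (X : uLie N) : inner ℝ X (zeitlinField X) = 0 := by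
  rw [inner_eq_neg_trace, coe_zeitlinField, commN, Matrix.mul_neg, Matrix.trace_neg,
    Matrix.mul_smul, Matrix.trace_smul, Matrix.mul_sub, Matrix.trace_sub,
    Matrix.trace_mul_comm X.1 (streamMatrix X.1 * X.1), Matrix.trace_mul_comm X.1 (X.1 * _),
    Matrix.mul_assoc X.1, Matrix.trace_mul_comm X.1 (streamMatrix X.1 * X.1), sub_self]
  simp

theorem IsZeitlinSolution.hasDerivWithinAt {N : ℕ} {T : ℝ} {W : ℝ → uLie N}
    (h : IsZeitlinSolution T W) : ∀ t ∈ Set.Icc 0 T,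
      HasDerivWithinAt W (zeitlinField (W t)) (Set.Icc 0 T) t := by
  intro t ht
  obtain ⟨V, hV, hd⟩ := h t ht
  rwa [uLie.ext (hV.trans (coe_zeitlinField (W t)).symm)] at hd

/-- The Frobenius norm is constant along solutions of the Zeitlin model. -/
theorem IsZeitlinSolution.norm_eq {N : ℕ} {T : ℝ} {W : ℝ → uLie N} (h : IsZeitlinSolution T W) :
    ∀ t ∈ Set.Icc 0 T, ‖W t‖ = ‖W 0‖ := by
  intro t ht
  have hd : ∀ s ∈ Set.Icc 0 T, HasDerivWithinAt (fun s => ‖W s‖ ^ 2) 0 (Set.Icc 0 T) s := by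
    intro s hs
    have := (h.hasDerivWithinAt s hs).norm_sq
    rwa [inner_zeitlinField, mul_zero] at this
  have := (convex_Icc 0 T).norm_image_sub_le_of_norm_hasDerivWithin_le hd (C := 0)
    (fun _ _ => by simp) (⟨le_rfl, ht.1.trans ht.2⟩ : (0 : ℝ) ∈ Set.Icc 0 T) ht
  rw [zero_mul, norm_le_zero_iff, sub_eq_zero] at this
  exact (sq_eq_sq₀ (norm_nonneg _) (norm_nonneg _)).1 this

/-- For small step sizes the isospectral integrator is a smooth map, of second order. -/
theorem exists_isoStep_map {N : ℕ} {R : ℝ} (hR : 0 < R) :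
    ∃ δ : ℝ, 0 < δ ∧ ∃ C : ℝ, ∀ Δt : ℝ, 0 < Δt → Δt < δ → ∃ σ Φ : uLie N → uLie N,
      ContDiffOn ℝ ∞ σ (Metric.ball 0 R) ∧
      (∀ Y ∈ Metric.ball (0 : uLie N) R, ∀ X Y' : Matrix (Fin N) (Fin N) ℂ,
        IsIsoStep Δt Y X Y' ↔ X = σ Y ∧ Y' = Φ Y) ∧
      (∀ W : ℝ → uLie N, IsZeitlinSolution Δt W → ‖W 0‖ < R →
        ‖Φ (W 0) - W Δt‖ ≤ C * Δt ^ 3) := by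
  obtain ⟨LF, hLF0, hLF⟩ := exists_lipschitz_closedBall (contDiff_zeitlinField (N := N)) (2 * R)
  obtain ⟨LG, hLG0, hLG⟩ :=
    exists_lipschitz_closedBall (contDiff_zeitlinCorrection (N := N)) (2 * R)
  obtain ⟨C, hC⟩ := exists_local_error_bound (contDiff_zeitlinField (N := N))
    contDiff_zeitlinCorrection R
  -- With τ = Δt/2 < 1 one has τ² ≤ τ, so the deviation of the Cayley map from the identity has
  -- Lipschitz constant at most Δt (LF + LG)/2 ≤ 1/2 on the ball of radius 2R.
  refine ⟨min 1 (1 / (LF + LG + 1)), by positivity, C, fun Δt hΔt hδ => ?_⟩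
  have hδ1 : Δt < 1 := hδ.trans_le (min_le_left _ _)
  have hδ2 : Δt * (LF + LG + 1) < 1 := by
    rw [← lt_div_iff₀ (by positivity)]
    exact hδ.trans_le (min_le_right _ _)
  have hε : Δt / (2 * hbar N) = (Δt / 2) / hbar N := by rw [div_div]
  have hε' : -(Δt / (2 * hbar N)) = (-(Δt / 2)) / hbar N := by rw [hε, neg_div]
  have hlip : ∀ x ∈ Metric.closedBall (0 : uLie N) (2 * R),
      ∀ y ∈ Metric.closedBall (0 : uLie N) (2 * R),
      ‖cayleyMap (Δt / (2 * hbar N)) x - cayleyMap (Δt / (2 * hbar N)) y - (x - y)‖ ≤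
        1 / 2 * ‖x - y‖ := by
    intro x hx y hy
    have e : cayleyMap (Δt / (2 * hbar N)) x - cayleyMap (Δt / (2 * hbar N)) y - (x - y) =
        -((Δt / 2) • (zeitlinField x - zeitlinField y) +
          (Δt / 2) ^ 2 • (zeitlinCorrection x - zeitlinCorrection y)) := by
      rw [hε, cayleyMap_eq, cayleyMap_eq]
      module
    rw [e, norm_neg]
    calc _ ≤ Δt / 2 * ‖zeitlinField x - zeitlinField y‖ +
          (Δt / 2) ^ 2 * ‖zeitlinCorrection x - zeitlinCorrection y‖ := by
          refine (norm_add_le _ _).trans (le_of_eq ?_)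
          rw [norm_smul, norm_smul, Real.norm_of_nonneg (by positivity),
            Real.norm_of_nonneg (by positivity)]
      _ ≤ Δt / 2 * (LF * ‖x - y‖) + Δt / 2 * (LG * ‖x - y‖) := by
          gcongr
          · exact hLF x hx y hy
          · nlinarith
          · exact hLG x hx y hy
      _ = 1 / 2 * (Δt * (LF + LG)) * ‖x - y‖ := by ring
      _ ≤ 1 / 2 * 1 * ‖x - y‖ := by
          gcongr
          nlinarith
      _ = _ := by ring
  obtain ⟨σ, hσ, hσ'⟩ := exists_smooth_inverse (contDiff_cayleyMap (N := N) (Δt / (2 * hbar N)))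
    (by simp [cayleyMap]) hR hlip (norm_le_norm_cayleyMap _)
  refine ⟨σ, fun Y => cayleyMap (-(Δt / (2 * hbar N))) (σ Y), hσ, fun Y hY X Y' => ?_,
    fun W hW h0 => ?_⟩
  · rw [isIsoStep_iff_cayleyMap]
    constructor
    · rintro ⟨X₀, rfl, h1, rfl⟩
      obtain rfl := (hσ' Y hY X₀).1 h1
      exact ⟨rfl, rfl⟩
    · rintro ⟨rfl, rfl⟩
      exact ⟨σ Y, rfl, (hσ' Y hY _).2 rfl, rfl⟩
  · have hY : W 0 ∈ Metric.ball (0 : uLie N) R := by rwa [mem_ball_zero_iff]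
    have hX := (hσ' (W 0) hY _).2 rfl
    have hXn := norm_le_norm_cayleyMap (Δt / (2 * hbar N)) (σ (W 0))
    rw [hX] at hXn
    have := hC Δt (σ (W 0)) W hΔt hδ1.le (hXn.trans h0.le)
      (fun t ht => (hW.norm_eq t ht).trans_le h0.le) hW.hasDerivWithinAt (by
        rw [← cayleyMap_eq, ← hε, hX])
    beta_reduce
    rw [hε', cayleyMap_eq, neg_smul, neg_sq, sub_neg_eq_add]
    exact this

/-- Places U S₀ U* in the ball of radius R for every U in the Stiefel manifold, so one δ serves all
of them. -/
theorem frobNorm_stiefel_conj {N r : ℕ} {U V : Matrix (Fin N) (Fin r) ℂ} (hU : U ∈ stiefel N r)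
    (hV : V ∈ stiefel N r) (S : Matrix (Fin r) (Fin r) ℂ) :
    frobNorm (U * S * Uᴴ) = frobNorm (V * S * Vᴴ) := by
  have h : ∀ {U : Matrix (Fin N) (Fin r) ℂ}, U ∈ stiefel N r →
      ((U * S * Uᴴ)ᴴ * (U * S * Uᴴ)).trace = (Sᴴ * S).trace := by
    intro U hU
    have hU' : Uᴴ * U = 1 := hU
    rw [Matrix.conjTranspose_mul, Matrix.conjTranspose_mul, Matrix.conjTranspose_conjTranspose]
    calc (U * (Sᴴ * Uᴴ) * (U * S * Uᴴ)).trace = (U * (Sᴴ * (Uᴴ * U) * S * Uᴴ)).trace := by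
          simp only [Matrix.mul_assoc]
      _ = (Sᴴ * S * (Uᴴ * U)).trace := by
          rw [Matrix.trace_mul_comm, hU']; simp only [Matrix.mul_assoc, hU', Matrix.mul_one]
      _ = _ := by rw [hU', Matrix.mul_one]
  rw [frobNorm, frobNorm, h hU, h hV]

end Zeitlin

theorem mainTheorem4 (N r : ℕ) (hN : 2 ≤ N) (hr : r ≤ N)
    (W₀ : Matrix (Fin N) (Fin N) ℂ) (hW₀ : Zeitlin.MemSu W₀)
    (U₀ : Matrix (Fin N) (Fin r) ℂ) (S₀ : Matrix (Fin r) (Fin r) ℂ)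
    (hU₀ : Zeitlin.IsLeadingEigen hr W₀ U₀ S₀)
    (Y₀ : Matrix (Fin N) (Fin N) ℂ) (hY₀ : Y₀ = U₀ * S₀ * U₀ᴴ) :
    -- the initial data: `Y₀` is a best rank-`r` approximation of `W₀`
    (U₀ ∈ Zeitlin.stiefel N r ∧ Y₀ ∈ skewAdjoint (Matrix (Fin N) (Fin N) ℂ) ∧
      Zeitlin.IsBestRankApprox r W₀ Y₀) ∧
    -- the implicit midpoint rule preserves the Stiefel manifold
    (∀ Δt : ℝ, 0 < Δt → ∀ U ∈ Zeitlin.stiefel N r, ∀ U' : Matrix (Fin N) (Fin r) ℂ,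
      Zeitlin.IsMidpointStep (Zeitlin.reconField S₀) Δt U U' → U' ∈ Zeitlin.stiefel N r) ∧
    -- its steps descend exactly to the steps of the isospectral integrator
    (∀ Δt : ℝ, 0 < Δt → ∀ U ∈ Zeitlin.stiefel N r, ∀ X Y' : Matrix (Fin N) (Fin N) ℂ,
      (∃ U' Ut : Matrix (Fin N) (Fin r) ℂ,
        Zeitlin.IsMidpointStep (Zeitlin.reconField S₀) Δt U U' ∧
        Ut = (1 / 2 : ℝ) • (U' + U) ∧ X = Ut * S₀ * Utᴴ ∧ Y' = U' * S₀ * U'ᴴ) ↔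
      Zeitlin.IsIsoStep Δt (U * S₀ * Uᴴ) X Y') ∧
    -- the numerical trajectories of the two schemes coincide
    (∀ Δt : ℝ, 0 < Δt → ∀ (n : ℕ) (Y : ℕ → Matrix (Fin N) (Fin N) ℂ),
      (∃ U : ℕ → Matrix (Fin N) (Fin r) ℂ, U 0 = U₀ ∧
        (∀ τ < n, Zeitlin.IsMidpointStep (Zeitlin.reconField S₀) Δt (U τ) (U (τ + 1))) ∧
        ∀ τ ≤ n, Y τ = U τ * S₀ * (U τ)ᴴ) ↔
      (Y 0 = Y₀ ∧ ∀ τ < n, ∃ X, Zeitlin.IsIsoStep Δt (Y τ) X (Y (τ + 1)))) ∧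
    -- along them `U` stays on the Stiefel manifold and `Y` on the co-adjoint orbit of `Y₀`
    (∀ Δt : ℝ, 0 < Δt → ∀ (n : ℕ) (U : ℕ → Matrix (Fin N) (Fin r) ℂ), U 0 = U₀ →
      (∀ τ < n, Zeitlin.IsMidpointStep (Zeitlin.reconField S₀) Δt (U τ) (U (τ + 1))) →
      ∀ τ ≤ n, U τ ∈ Zeitlin.stiefel N r ∧ U τ * S₀ * (U τ)ᴴ ∈ Zeitlin.coadjointOrbit Y₀) ∧
    -- for every step size, each smooth branch of the scheme is an isospectral Lie-Poisson map
    (∀ Δt : ℝ, 0 < Δt → ∀ (D : Set (Zeitlin.uLie N)) (σ Φ : Zeitlin.uLie N → Zeitlin.uLie N),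
      IsOpen D → ContDiffOn ℝ ∞ σ D → (∀ Y ∈ D, Zeitlin.IsIsoStep (N := N) Δt Y (σ Y) (Φ Y)) →
      Zeitlin.IsLiePoissonMapOn D Φ ∧
      ∀ Y ∈ D, (Φ Y : Matrix (Fin N) (Fin N) ℂ) ∈ Zeitlin.coadjointOrbit Y) ∧
    -- for small step sizes both schemes are well-defined maps, and the one induced on `𝔲(N)` is an
    -- isospectral Lie-Poisson map and a second order integrator near the co-adjoint orbit of `Y₀`
    (∀ R : ℝ, Zeitlin.frobNorm Y₀ < R → ∃ δ : ℝ, 0 < δ ∧ ∃ C : ℝ, ∀ Δt : ℝ, 0 < Δt → Δt < δ →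
      (∀ U ∈ Zeitlin.stiefel N r, ∃! U' : Matrix (Fin N) (Fin r) ℂ,
        Zeitlin.IsMidpointStep (Zeitlin.reconField S₀) Δt U U') ∧
      ∃ σ Φ : Zeitlin.uLie N → Zeitlin.uLie N,
        ContDiffOn ℝ ∞ σ (Metric.ball 0 R) ∧
        (∀ Y ∈ Metric.ball (0 : Zeitlin.uLie N) R, ∀ X Y' : Matrix (Fin N) (Fin N) ℂ,
          Zeitlin.IsIsoStep Δt Y X Y' ↔ X = σ Y ∧ Y' = Φ Y) ∧
        (∀ U ∈ Zeitlin.stiefel N r, ∀ U' : Matrix (Fin N) (Fin r) ℂ,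
          Zeitlin.IsMidpointStep (Zeitlin.reconField S₀) Δt U U' →
          ∀ Y : Zeitlin.uLie N, (Y : Matrix (Fin N) (Fin N) ℂ) = U * S₀ * Uᴴ →
            (Φ Y : Matrix (Fin N) (Fin N) ℂ) = U' * S₀ * U'ᴴ) ∧
        Zeitlin.IsLiePoissonMapOn (Metric.ball 0 R) Φ ∧
        (∀ Y ∈ Metric.ball (0 : Zeitlin.uLie N) R,
          (Φ Y : Matrix (Fin N) (Fin N) ℂ) ∈ Zeitlin.coadjointOrbit Y) ∧
        (∀ W : ℝ → Zeitlin.uLie N, Zeitlin.IsZeitlinSolution Δt W → ‖W 0‖ < R →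
          ‖Φ (W 0) - W Δt‖ ≤ C * Δt ^ 3)) := by
  have hW : W₀ᴴ = -W₀ := hW₀.1
  have hS := hU₀.conjTranspose_eq_neg hW
  have hU := hU₀.mem_stiefel
  subst hY₀
  refine ⟨⟨hU, Zeitlin.conjTranspose_conj_skew hS U₀, hU₀.isBestRankApprox⟩,
    fun Δt _ U hU U' h => h.mem_stiefel hS hU, fun Δt _ U _ X Y' => ⟨?_, fun h => h.exists_midpoint⟩,
    fun Δt _ n Y => ⟨?_, fun h => Zeitlin.exists_midpoint_trajectory U₀ h.1 n h.2⟩,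
    fun Δt _ n U h0 h => ?_, fun Δt _ D σ Φ hD hσ h =>
      ⟨Zeitlin.isLiePoissonMapOn_of_isIsoStep hD hσ h, fun Y hY => (h Y hY).mem_coadjointOrbit⟩,
    fun R hR => ?_⟩
  · rintro ⟨U', Ut, h, ht, rfl, rfl⟩
    exact Zeitlin.isIsoStep_of_midpoint hS h ht
  · rintro ⟨U, h0, h1, h2⟩
    refine ⟨by rw [h2 0 (Nat.zero_le n), h0], fun τ hτ => ?_⟩
    rw [h2 τ hτ.le, h2 (τ + 1) hτ]
    exact ⟨_, Zeitlin.isIsoStep_of_midpoint hS (h1 τ hτ) rfl⟩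
  · subst h0
    exact Zeitlin.midpoint_trajectory hS hU h
  · obtain ⟨δ, hδ, C, hC⟩ := Zeitlin.exists_isoStep_map (N := N) ((Real.sqrt_nonneg _).trans_lt hR)
    refine ⟨δ, hδ, C, fun Δt hΔt hΔt' => ?_⟩
    obtain ⟨σ, Φ, hσ, hstep, hord⟩ := hC Δt hΔt hΔt'
    have hball : ∀ U ∈ Zeitlin.stiefel N r, ∀ Y : Zeitlin.uLie N,
        (Y : Matrix (Fin N) (Fin N) ℂ) = U * S₀ * Uᴴ → Y ∈ Metric.ball (0 : Zeitlin.uLie N) R := by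
      intro U hU' Y hY
      rwa [mem_ball_zero_iff, Zeitlin.norm_eq_frobNorm, hY, Zeitlin.frobNorm_stiefel_conj hU' hU]
    have hself : ∀ Y ∈ Metric.ball (0 : Zeitlin.uLie N) R,
        Zeitlin.IsIsoStep (N := N) Δt Y (σ Y) (Φ Y) := fun Y hY =>
      (hstep Y hY _ _).2 ⟨rfl, rfl⟩
    refine ⟨fun U hU' => ?_, σ, Φ, hσ, hstep, fun U hU' U' h Y hY => ?_,
      Zeitlin.isLiePoissonMapOn_of_isIsoStep Metric.isOpen_ball hσ hself,
      fun Y hY => (hself Y hY).mem_coadjointOrbit, hord⟩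
    · let Y := Zeitlin.ofSkew _ (Zeitlin.conjTranspose_conj_skew hS U)
      have hY := hball U hU' Y rfl
      have hs : Zeitlin.IsIsoStep Δt (U * S₀ * Uᴴ) (σ Y).1 (Φ Y).1 := hself Y hY
      obtain ⟨U', Ut, h, ht, hX, -⟩ := hs.exists_midpoint
      -- Two midpoint steps from U descend to integrator steps from the same Y, hence share the
      -- unique stage, and the stage determines the step.
      refine ⟨U', h, fun U'' h'' => ?_⟩
      have h2 := ((hstep Y hY _ _).1 (Zeitlin.isIsoStep_of_midpoint hS h'' rfl)).1
      exact h''.unique_of_stage hS rfl h ht (h2.trans hX)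
    · have h2 := Zeitlin.isIsoStep_of_midpoint hS h rfl
      rw [← hY] at h2
      exact ((hstep Y (hball U hU' Y hY) _ _).1 h2).2.symm
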